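/- Let $\rho>0$ and let $\lambda,\mu\in\mathbb R$ satisfy $\mu>0$, $3\lambda+2\mu>0$. Let $T>0$, $R>0$, $p>5/2$, $M>0$, $\delta>0$ and $x_0\in B_R:=\{x\in\mathbb R^3:|x|<R\}$. Let $\mathcal A$ be the set of all (continuous representatives of) functions $h\in H^p(\mathbb R^3)$ with $\|h\|_{H^p(\mathbb R^3)}\le M$, $|h(x_0)|\ge\delta$ and $\operatorname{supp}h\subset B_R$. Functions may be complex-valued. For $f\in\mathcal A$ and $g\in L^2(0,T)^3$ consider the Lamé system $$\rho\,\partial_{tt}U=\nabla\cdot\sigma(U)+f(x)g(t)\ \text{ in }\mathbb R^3\times(0,T),\qquad U(\cdot,0)=\partial_tU(\cdot,0)=0,$$ where $\sigma(U)_{ij}=\sum_{k,l}C_{ijkl}\,\partial_lU_k$ and $C_{ijkl}=\lambda\delta_{ij}\delta_{kl}+\mu(\delta_{ik}\delta_{jl}+\delta_{il}\delta_{jk})$. A solution is understood as follows: $U\in C([0,T];L^2(\mathbb R^3))^3$, each $U(\cdot,t)$, $t\in[0,T]$, is represented by a continuous function of $x$ (so that $U(x_0,t)$ makes sense), and for every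 Schwartz function $\varphi$ and each $i$ the function $t\mapsto\langle U_i(t),\varphi\rangle$ belongs to $H^2(0,T)$, vanishes at $t=0$ together with its first derivative, and satisfies $\rho\,\partial_{tt}\langle U_i(t),\varphi\rangle=\langle(\nabla\cdot\sigma(U(t)))_i,\varphi\rangle+g_i(t)\langle f,\varphi\rangle$ for almost every $t\in(0,T)$. (In particular, every solution in $C([0,T];H^{p+1}(\mathbb R^3))^3\cap H^2((0,T);H^{p-1}(\mathbb R^3))^3$ is of this kind.) There is a constant $C>0$, depending only on $\lambda,\mu,\rho,p,x_0,M,R,\delta,T$, such that for every $f\in\mathcal A$, every $g\in L^2(0,T)^3$ and every solution $U$ of the system with source $f(x)g(t)$, one has $U(x_0,\cdot)\in H^2(0,T)^3$ and $$\|g\|_{L^2(0,T)^3}\le C\,\|\partial_{tt}U(x_0,\cdot)\|_{L^2(0,T)^3}.$$ In particular, for given $f\in\mathcal A$ the data $\{U(x_0,t):t\in(0,T)\}$ determine $g$ uniquely: if $U_1,U_2$ are solutions with sources $f g_1$, $f g_2$, where $g_1,g_2\in L^2(0,T)^3$, and $U_1(x_0,t)=U_2(x_0,t)$ for all $t\in(0,T)$,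 then $g_1=g_2$ almost everywhere in $(0,T)$. -/

import Mathlib

open MeasureTheory Set
open scoped SchwartzMap LineDeriv ENNReal

noncomputable section

namespace Lame

/-- The physical space `ℝ³`. -/
abbrev Space := EuclideanSpace ℝ (Fin 3)

/-- The target space `ℂ³` of displacements and temporal functions, with its Euclidean norm. -/
abbrev Vec := EuclideanSpace ℂ (Fin 3)

/-- `L²(ℝ³)`. Its elements are regarded as tempered distributions through the coercion to
`𝓢'(Space, ℂ)`, which sends `u` to `φ ↦ ∫ φ u`. -/
abbrev L2 := Lp ℂ 2 (volume : Measure Space)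

/-- The function `h` belongs to `H^s(ℝ³)` and `‖h‖_{H^s} ≤ M`. The norm is the `L²` norm of the
Bessel potential of order `s` of `h`, that is, of `(1 + |ξ|²)^(s/2) (𝓕 h)(ξ)`, where `𝓕` has the
kernel `exp (-2 π i x ⬝ ξ)`. For fixed `s`, the kernel `exp (-i x ⬝ ξ)` gives an equivalent norm. -/
def SobolevNormLE (s : ℝ) (h : Space → ℂ) (M : ℝ) : Prop :=
  ∃ (hL : MemLp h 2 (volume : Measure Space)) (b : L2),
    TemperedDistribution.besselPotential Space ℂ s ((hL.toLp h : L2) : 𝓢'(Space, ℂ)) =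
      (b : 𝓢'(Space, ℂ)) ∧ ‖b‖ ≤ M

/-- The admissible spatial source functions: those `h ∈ H^p(ℝ³)` with `‖h‖_{H^p} ≤ M`,
`|h(x₀)| ≥ δ` and `supp h ⊆ B_R`. The elements of `H^p(ℝ³)`, `p > 3/2`, are identified with their
continuous representatives, so that `h(x₀)` makes sense. -/
def admissible (x₀ : Space) (p δ M R : ℝ) : Set (Space → ℂ) :=
  {h | Continuous h ∧ SobolevNormLE p h M ∧ δ ≤ ‖h x₀‖ ∧ tsupport h ⊆ Metric.ball 0 R}

/-- The stiffness tensor `C_{ijkl}` of an isotropic homogeneous medium with Lamé constants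
`lam`, `mu`. -/
def stiffness (lam mu : ℝ) (i j k l : Fin 3) : ℝ :=
  let d : Fin 3 → Fin 3 → ℝ := fun a b => if a = b then 1 else 0
  lam * (d i j * d k l) + mu * (d i k * d j l + d i l * d j k)

/-- The partial derivative `∂_j` of a tempered distribution on `ℝ³`. -/
def partialDeriv (j : Fin 3) (u : 𝓢'(Space, ℂ)) : 𝓢'(Space, ℂ) :=
  ∂_{(EuclideanSpace.single j (1 : ℝ) : Space)} u

/-- The stress tensor `σ(u) = C : ∇u` (Hooke's law), with `(∇u)_{kl} = ∂_l u_k` taken in the sense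
of distributions. -/
def stress (lam mu : ℝ) (u : Fin 3 → 𝓢'(Space, ℂ)) (i j : Fin 3) : 𝓢'(Space, ℂ) :=
  ∑ k, ∑ l, (stiffness lam mu i j k l : ℂ) • partialDeriv l (u k)

/-- The divergence `(∇ ⬝ σ(u))_i = ∑_j ∂_j σ(u)_{ij}` of the stress tensor. -/
def divStress (lam mu : ℝ) (u : Fin 3 → 𝓢'(Space, ℂ)) (i : Fin 3) : 𝓢'(Space, ℂ) :=
  ∑ j, partialDeriv j (stress lam mu u i j)

/-- `u` belongs to `H²((0,T); X)`, and `v = ∂_t u`, `w = ∂_{tt} u`. As usual in one variable, `u`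
and `v` are taken to be the absolutely continuous representatives: they are the primitives of
`v` and `w`, and `w` is square integrable. This determines `v` on `[0,T]` and `w` almost everywhere
in `(0,T)`. -/
structure IsH2 {X : Type*} [NormedAddCommGroup X] [NormedSpace ℝ X] (T : ℝ) (u v w : ℝ → X) :
    Prop where
  memLp : MemLp w 2 (volume.restrict (Ioo 0 T))
  eq_integral : ∀ t ∈ Icc 0 T, u t = u 0 + ∫ s in (0 : ℝ)..t, v s
  deriv_eq_integral : ∀ t ∈ Icc 0 T, v t = v 0 + ∫ s in (0 : ℝ)..t, w s

/-- `U` (with `U t x` the displacement at time `t` and position `x`) is a weak solution of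
`rho ∂_{tt} U = ∇ ⬝ σ(U) + f(x) g(t)` in `ℝ³ × (0,T)` with `U(⬝,0) = ∂_t U(⬝,0) = 0`.
It is a curve in `C([0,T]; L²(ℝ³))³` that at every time is given by a continuous function of `x`
(so that `U(x₀,t)` makes sense), and for every test function `φ` the pairing `⟨U_i(t), φ⟩` is in
`H²(0,T)`, vanishes at `t = 0` together with its first derivative, and satisfies
`rho ∂_{tt} ⟨U_i(t), φ⟩ = ⟨(∇ ⬝ σ(U(t)))_i, φ⟩ + g_i(t) ⟨f, φ⟩` for almost every `t ∈ (0,T)`. -/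
def IsSolution (rho lam mu T : ℝ) (f : Space → ℂ) (g : ℝ → Vec) (U : ℝ → Space → Vec) : Prop :=
  ∃ V : ℝ → Fin 3 → L2,
    (∀ i, ContinuousOn (fun t => V t i) (Icc 0 T)) ∧
    (∀ t ∈ Icc 0 T, Continuous (U t) ∧ ∀ i, V t i =ᵐ[volume] fun x => U t x i) ∧
    ∀ (i : Fin 3) (φ : 𝓢(Space, ℂ)), ∃ v w : ℝ → ℂ,
      IsH2 T (fun t => (V t i : 𝓢'(Space, ℂ)) φ) v w ∧
      (V 0 i : 𝓢'(Space, ℂ)) φ = 0 ∧ v 0 = 0 ∧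
      ∀ᵐ t ∂volume.restrict (Ioo 0 T),
        (rho : ℂ) * w t =
          divStress lam mu (fun k => (V t k : 𝓢'(Space, ℂ))) i φ + g t i * ∫ x, φ x * f x

end Lame

end

/-! In Fourier variables the Lamé operator is multiplication by a symmetric matrix whose eigenspaces
are the line through `ξ` and its orthogonal complement, with eigenvalues `a²|ξ|²` and `b²|ξ|²` (up
to sign and the factor `rho`). The matrix wave equation is therefore solved explicitly by `kern`,
and Duhamel's formula gives `Û(t) = rho⁻¹ f̂ ∫₀ᵗ kern(t - s) g(s) ds`. Fourier inversion at `x₀`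
turns this into `U(x₀,·) = κ * g` with a 3×3 matrix kernel `κ` depending on `f` only.

Each time derivative of `κ` beyond the first costs one power of `|ξ|`. For `p > 5/2`, Cauchy–Schwarz
puts `|ξ| f̂` in `L¹` with norm at most `sobolevConst p * M`, so `κ` is of class `C²` with `κ''`
bounded in terms of `M`. Moreover `κ(0) = 0` and `κ'(0) = (f(x₀)/rho) I`. Differentiating twice
gives `∂_tt U(x₀,·) = (f(x₀)/rho) g + κ'' * g`, a Volterra equation of the second kind for `g`,
whose leading coefficient is at least `δ/rho` in modulus. Gronwall's inequality yields the estimate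
(`eLpNorm_le_of_volterra`, `isH2_matrixConv`).

The delicate point is that Duhamel's formula must hold for every weak solution
(`sum_pairing_eq_duhamel`). Tested against `𝓕 ψ` with `ψ` of compact support, the difference `d_ψ`
between a solution and Duhamel's formula satisfies `d_ψ'' = -d_{Aψ}` with zero initial data, where
`A = lameOp` is a multiplication operator, bounded on functions supported in a fixed ball. Iterating
`n` times gives `|d_ψ(t)| ≤ C Lⁿ t²ⁿ/(2n)!`, hence `d_ψ = 0`, without any energy estimate. Such `ψ`
determine `Û(t)` almost everywhere. -/

namespace Lame

/-! ### Convolution on the half-line -/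

section Convolution

variable {K : ℝ → ℂ} {g : ℝ → ℂ} {t : ℝ}

/-- The kernel `(r, s) ↦ K (r - s) g s` on the triangle `0 < s < r ≤ t` is integrable. -/
lemma integrable_causal_kernel (hK : Continuous K) (hg : IntegrableOn g (Ioc 0 t)) :
    Integrable (fun q : ℝ × ℝ => {q : ℝ × ℝ | q.2 < q.1}.indicator
      (fun q => K (q.1 - q.2) * g q.2) q)
      ((volume.restrict (Ioc 0 t)).prod (volume.restrict (Ioc 0 t))) := by
  obtain ⟨B, hB⟩ := (isCompact_Icc (a := -t) (b := t)).exists_bound_of_continuousOn hK.continuousOn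
  refine Integrable.indicator ?_ (measurableSet_lt measurable_snd measurable_fst)
  have h2 : Integrable (fun q : ℝ × ℝ => g q.2)
      ((volume.restrict (Ioc 0 t)).prod (volume.restrict (Ioc 0 t))) :=
    Integrable.comp_snd hg _
  refine h2.bdd_mul (c := B) ?_ ?_
  · exact (by fun_prop : Continuous fun q : ℝ × ℝ => K (q.1 - q.2)).aestronglyMeasurable
  · rw [Measure.prod_restrict]
    filter_upwards [ae_restrict_mem (measurableSet_Ioc.prod measurableSet_Ioc)] with q hq
    obtain ⟨h1, h2⟩ := hq
    exact hB _ ⟨by linarith [h1.1, h2.2], by linarith [h1.2, h2.1]⟩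

lemma integral_causal_kernel_right {r : ℝ} (hr : r ∈ Ioc 0 t) :
    ∫ s in Ioc 0 t, {q : ℝ × ℝ | q.2 < q.1}.indicator (fun q => K (q.1 - q.2) * g q.2) (r, s) =
      ∫ s in (0 : ℝ)..r, K (r - s) * g s := by
  have : ∀ s, {q : ℝ × ℝ | q.2 < q.1}.indicator (fun q => K (q.1 - q.2) * g q.2) (r, s) =
      (Iio r).indicator (fun s => K (r - s) * g s) s := by
    intro s; simp [indicator]
  simp_rw [this]
  rw [setIntegral_indicator measurableSet_Iio, intervalIntegral.integral_of_le hr.1.le,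
    integral_Ioc_eq_integral_Ioo]
  congr 2
  ext s
  simp only [mem_inter_iff, mem_Ioc, mem_Iio, mem_Ioo]
  exact ⟨fun h => ⟨h.1.1, h.2⟩, fun h => ⟨⟨h.1, h.2.le.trans hr.2⟩, h.2⟩⟩

/-- A convolution with a continuous kernel is integrable. -/
lemma intervalIntegrable_conv (hK : Continuous K) (ht : 0 ≤ t)
    (hg : IntervalIntegrable g volume 0 t) :
    IntervalIntegrable (fun r => ∫ s in (0 : ℝ)..r, K (r - s) * g s) volume 0 t := by
  rw [intervalIntegrable_iff_integrableOn_Ioc_of_le ht] at hg ⊢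
  refine (integrable_causal_kernel hK hg).integral_prod_left.congr ?_
  filter_upwards [ae_restrict_mem measurableSet_Ioc] with r hr
  exact integral_causal_kernel_right hr

/-- A convolution with a continuously differentiable kernel is a primitive. -/
lemma conv_eq_integral {K' : ℝ → ℂ} (hK : ∀ τ, HasDerivAt K (K' τ) τ) (hK' : Continuous K')
    (ht : 0 ≤ t) (hg : IntervalIntegrable g volume 0 t) :
    ∫ s in (0 : ℝ)..t, K (t - s) * g s =
      ∫ r in (0 : ℝ)..t, (K 0 * g r + ∫ s in (0 : ℝ)..r, K' (r - s) * g s) := by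
  have hKc : Continuous K := continuous_iff_continuousAt.2 fun τ => (hK τ).continuousAt
  rw [intervalIntegral.integral_add (hg.const_mul _) (intervalIntegrable_conv hK' ht hg)]
  -- With the boundary term on the left, the integrand is `(K(t - s) - K(0)) g(s)`. Writing the
  -- bracket as `∫_s^t K'(r - s) dr` reduces the claim to Fubini on the triangle.
  rw [← sub_eq_iff_eq_add', ← intervalIntegral.integral_sub
    (hg.continuousOn_mul (by fun_prop)) (hg.const_mul _)]
  have hg' := (intervalIntegrable_iff_integrableOn_Ioc_of_le ht).1 hg
  have hsw := integral_integral_swap (f := fun r s => {q : ℝ × ℝ | q.2 < q.1}.indicator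
    (fun q => K' (q.1 - q.2) * g q.2) (r, s)) (integrable_causal_kernel hK' hg')
  rw [intervalIntegral.integral_of_le ht, intervalIntegral.integral_of_le ht]
  calc _ = ∫ s in Ioc 0 t, ∫ r in Ioc 0 t, {q : ℝ × ℝ | q.2 < q.1}.indicator
          (fun q => K' (q.1 - q.2) * g q.2) (r, s) := by
        refine setIntegral_congr_fun measurableSet_Ioc fun s hs => ?_
        have : ∀ r, {q : ℝ × ℝ | q.2 < q.1}.indicator (fun q => K' (q.1 - q.2) * g q.2) (r, s) =
            (Ioi s).indicator (fun r => K' (r - s) * g s) r := by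
          intro r; simp [indicator]
        simp_rw [this]
        have hst : Ioc 0 t ∩ Ioi s = Ioc s t := by
          ext r; simp only [mem_inter_iff, mem_Ioc, mem_Ioi]
          exact ⟨fun h => ⟨h.2, h.1.2⟩, fun h => ⟨⟨hs.1.trans h.1, h.2⟩, h.1⟩⟩
        rw [setIntegral_indicator measurableSet_Ioi, hst, ← intervalIntegral.integral_of_le hs.2,
          intervalIntegral.integral_mul_const, intervalIntegral.integral_comp_sub_right
          (fun r => K' r) s, sub_self,
          intervalIntegral.integral_eq_sub_of_hasDerivAt (fun x _ => hK x)
            (hK'.intervalIntegrable _ _)]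
        ring
    _ = _ := by
        rw [← hsw]
        exact setIntegral_congr_fun measurableSet_Ioc fun r hr => integral_causal_kernel_right hr

end Convolution

/-! ### Uniqueness by power iteration -/

/-- A family of functions with `d_ψ = -∫∫ d_{A ψ}` that is controlled by a quantity growing at most
geometrically under iteration of `A` vanishes. -/
lemma eq_zero_of_eq_neg_integral_integral {Ψ : Type*} {A : Ψ → Ψ} {S : Ψ → ℝ → Prop} {L c T : ℝ}
    {d : Ψ → ℝ → ℂ} (hL : 0 ≤ L) (hA : ∀ ψ N, S ψ N → S (A ψ) (L * N))
    (hS : ∀ ψ N, S ψ N → 0 ≤ N) (hd : ∀ ψ N, S ψ N → ∀ t ∈ Icc 0 T, ‖d ψ t‖ ≤ c * N)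
    (heq : ∀ ψ N, S ψ N → ∀ t ∈ Icc 0 T,
      d ψ t = ∫ s in (0 : ℝ)..t, ∫ r in (0 : ℝ)..s, -d (A ψ) r)
    {ψ : Ψ} {N : ℝ} (hψ : S ψ N) {t : ℝ} (ht : t ∈ Icc 0 T) : d ψ t = 0 := by
  -- The bound is for all `ψ` and `N` at once, because the induction step uses it for `A ψ` with `L
  -- * N`. Each step integrates twice in time, which produces the next even factorial.
  have key : ∀ n : ℕ, ∀ ψ N, S ψ N → ∀ t ∈ Icc 0 T,
      ‖d ψ t‖ ≤ c * N * L ^ n * (t ^ (2 * n) / (2 * n).factorial) := by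
    intro n
    induction n with
    | zero => intro ψ N h t ht; simpa using hd ψ N h t ht
    | succ n ih =>
      intro ψ N h t ht
      have hN := hS ψ N h
      have h1 : ∀ s ∈ Icc 0 T, ‖∫ r in (0 : ℝ)..s, -d (A ψ) r‖ ≤
          c * N * L ^ (n + 1) * (s ^ (2 * n + 1) / (2 * n + 1).factorial) := by
        intro s hs
        have : ∫ r in (0 : ℝ)..s, c * (L * N) * L ^ n * (r ^ (2 * n) / (2 * n).factorial) =
            c * N * L ^ (n + 1) * (s ^ (2 * n + 1) / (2 * n + 1).factorial) := by
          rw [intervalIntegral.integral_const_mul, intervalIntegral.integral_div, integral_pow,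
            Nat.factorial_succ]
          push_cast
          have : ((2 * n).factorial : ℝ) ≠ 0 := by positivity
          field_simp
          simp only [ne_eq, Nat.add_eq_zero_iff, one_ne_zero, and_false, not_false_eq_true,
            zero_pow, sub_zero]
          ring
        rw [← this]
        refine intervalIntegral.norm_integral_le_of_norm_le hs.1 ?_
          ((by fun_prop : Continuous fun r : ℝ =>
            c * (L * N) * L ^ n * (r ^ (2 * n) / (2 * n).factorial)).intervalIntegrable _ _)
        refine Filter.Eventually.of_forall fun r hr => ?_
        rw [norm_neg]
        exact ih (A ψ) (L * N) (hA ψ N h) r ⟨hr.1.le, hr.2.trans hs.2⟩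
      have h2 : ∫ s in (0 : ℝ)..t,
          c * N * L ^ (n + 1) * (s ^ (2 * n + 1) / (2 * n + 1).factorial) =
          c * N * L ^ (n + 1) * (t ^ (2 * (n + 1)) / (2 * (n + 1)).factorial) := by
        rw [intervalIntegral.integral_const_mul, intervalIntegral.integral_div, integral_pow,
          show 2 * (n + 1) = (2 * n + 1) + 1 by ring, Nat.factorial_succ (2 * n + 1)]
        push_cast
        have : ((2 * n + 1).factorial : ℝ) ≠ 0 := by positivity
        field_simp
        simp
      rw [heq ψ N h t ht, ← h2]
      refine intervalIntegral.norm_integral_le_of_norm_le ht.1 ?_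
          ((by fun_prop : Continuous fun s : ℝ =>
            c * N * L ^ (n + 1) * (s ^ (2 * n + 1) / (2 * n + 1).factorial)).intervalIntegrable _ _)
      exact Filter.Eventually.of_forall fun s hs => h1 s ⟨hs.1.le, hs.2.trans ht.2⟩
  -- `Lⁿ t²ⁿ/(2n)!` is an even-indexed term of the exponential series at `√L t`.
  have hlim : Filter.Tendsto (fun n : ℕ =>
      c * N * ((Real.sqrt L * t) ^ (2 * n) / (2 * n).factorial)) Filter.atTop (nhds 0) := by
    have h := (FloorSemiring.tendsto_pow_div_factorial_atTop (Real.sqrt L * t)).comp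
      (Filter.tendsto_id.const_mul_atTop' (r := 2) (by norm_num))
    simpa [Function.comp_def] using h.const_mul (c * N)
  refine norm_le_zero_iff.1 (ge_of_tendsto' hlim fun n => (key n ψ N hψ t ht).trans_eq ?_)
  rw [mul_pow, pow_mul (Real.sqrt L), Real.sq_sqrt hL]
  ring

/-! ### A Volterra inequality in `L²(0,T)` -/

/-- Cauchy–Schwarz against the constant 1, obtained by expanding the nonnegative integral of `(f -
mean)²`. -/
lemma sq_integral_le {f : ℝ → ℝ} {t : ℝ} (ht : 0 ≤ t) (hf : IntervalIntegrable f volume 0 t)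
    (hf2 : IntervalIntegrable (fun s => f s ^ 2) volume 0 t) :
    (∫ s in (0 : ℝ)..t, f s) ^ 2 ≤ t * ∫ s in (0 : ℝ)..t, f s ^ 2 := by
  rcases ht.eq_or_lt with rfl | ht
  · simp
  set I := ∫ s in (0 : ℝ)..t, f s with hI
  have h0 : 0 ≤ ∫ s in (0 : ℝ)..t, (f s - I / t) ^ 2 :=
    intervalIntegral.integral_nonneg ht.le fun s _ => sq_nonneg _
  have h1 : ∫ s in (0 : ℝ)..t, (f s - I / t) ^ 2 =
      (∫ s in (0 : ℝ)..t, f s ^ 2) - I ^ 2 / t := by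
    have : ∀ s, (f s - I / t) ^ 2 = f s ^ 2 - 2 * (I / t) * f s + (I / t) ^ 2 := fun s => by ring
    simp_rw [this]
    rw [intervalIntegral.integral_add (hf2.sub (hf.const_mul _)) (by simp),
      intervalIntegral.integral_sub hf2 (hf.const_mul _), intervalIntegral.integral_const_mul,
      ← hI, intervalIntegral.integral_const]
    simp only [sub_zero, smul_eq_mul]
    field_simp
    ring
  rw [h1, sub_nonneg, div_le_iff₀ ht] at h0
  linarith

/-- The constant in the Volterra inequality. -/
noncomputable def volterraConst (a b T : ℝ) : ℝ := Real.sqrt (2 * a ^ 2 * Real.exp (2 * b ^ 2 * T * T))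

lemma eLpNorm_two_eq_ofReal_sqrt {E : Type*} [NormedAddCommGroup E] {T : ℝ} (hT : 0 ≤ T)
    {g : ℝ → E} (hg : MemLp g 2 (volume.restrict (Ioo 0 T))) :
    eLpNorm g 2 (volume.restrict (Ioo 0 T)) =
      ENNReal.ofReal (Real.sqrt (∫ s in (0 : ℝ)..T, ‖g s‖ ^ 2)) := by
  rw [hg.eLpNorm_eq_integral_rpow_norm (by norm_num) (by norm_num),
    intervalIntegral.integral_of_le hT, integral_Ioc_eq_integral_Ioo, Real.sqrt_eq_rpow]
  norm_num

/-- Squaring and Cauchy–Schwarz give `‖g‖² ≤ 2a²‖w‖² + 2b²T ∫₀ᵗ ‖g‖²`. With `Y(t) = ∫₀ᵗ ‖g‖²` this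
integrates to `Y ≤ α + β ∫₀ᵗ Y`, and Gronwall gives `Y(T) ≤ α exp(βT)`, which is `volterraConst a b
T ^ 2` times the squared norm of `w`. Positivity of `b` keeps `β ≠ 0`. -/
lemma eLpNorm_le_of_volterra {E F : Type*} [NormedAddCommGroup E] [NormedAddCommGroup F]
    {T a b : ℝ} (hT : 0 < T) (hb : 0 < b) {g : ℝ → E} {w : ℝ → F}
    (hg : MemLp g 2 (volume.restrict (Ioo 0 T))) (hw : MemLp w 2 (volume.restrict (Ioo 0 T)))
    (h : ∀ᵐ t ∂volume.restrict (Ioo 0 T), ‖g t‖ ≤ a * ‖w t‖ + b * ∫ s in (0 : ℝ)..t, ‖g s‖) :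
    eLpNorm g 2 (volume.restrict (Ioo 0 T)) ≤
      ENNReal.ofReal (volterraConst a b T) * eLpNorm w 2 (volume.restrict (Ioo 0 T)) := by
  have hint : ∀ {f : ℝ → ℝ}, IntegrableOn f (Ioo 0 T) → IntervalIntegrable f volume 0 T := by
    intro f hf
    rwa [intervalIntegrable_iff_integrableOn_Ioo_of_le hT.le]
  have hg1 : IntervalIntegrable (fun s => ‖g s‖) volume 0 T :=
    hint (hg.integrable (by norm_num)).norm
  have hg2 : IntervalIntegrable (fun s => ‖g s‖ ^ 2) volume 0 T := hint hg.integrable_norm_pow'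
  have hw2 : IntervalIntegrable (fun s => ‖w s‖ ^ 2) volume 0 T := hint hw.integrable_norm_pow'
  have hsub : ∀ {f : ℝ → ℝ} {t : ℝ}, t ∈ Icc 0 T → IntervalIntegrable f volume 0 T →
      IntervalIntegrable f volume 0 t := fun ht hf =>
    hf.mono_set (by rw [uIcc_of_le hT.le, uIcc_of_le ht.1]; exact Icc_subset_Icc_right ht.2)
  set Y : ℝ → ℝ := fun t => ∫ s in (0 : ℝ)..t, ‖g s‖ ^ 2 with hY
  set W := ∫ s in (0 : ℝ)..T, ‖w s‖ ^ 2 with hW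
  have hYc : ContinuousOn Y (Icc 0 T) := by
    have := intervalIntegral.continuousOn_primitive_interval' hg2 (a := 0) (by simp)
    rwa [uIcc_of_le hT.le] at this
  have hY0 : ∀ t ∈ Icc 0 T, 0 ≤ Y t := fun t ht =>
    intervalIntegral.integral_nonneg ht.1 fun s _ => by positivity
  have hYi : IntervalIntegrable Y volume 0 T :=
    ContinuousOn.intervalIntegrable (by rwa [uIcc_of_le hT.le])
  have hW0 : 0 ≤ W := intervalIntegral.integral_nonneg hT.le fun s _ => by positivity
  set α := 2 * a ^ 2 * W
  set β := 2 * b ^ 2 * T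
  have hβ : 0 < β := by positivity
  set F : ℝ → ℝ := fun t => ∫ s in (0 : ℝ)..t, Y s with hF
  have hYF : ∀ t ∈ Icc 0 T, Y t ≤ α + β * F t := by
    intro t ht
    have hle : Y t ≤ ∫ s in (0 : ℝ)..t, (2 * a ^ 2 * ‖w s‖ ^ 2 + β * Y s) := by
      refine intervalIntegral.integral_mono_ae_restrict ht.1 (hsub ht hg2)
        (((hsub ht hw2).const_mul _).add ((hsub ht hYi).const_mul _)) ?_
      have h' : ∀ᵐ s ∂volume.restrict (Icc 0 t),
          ‖g s‖ ≤ a * ‖w s‖ + b * ∫ r in (0 : ℝ)..s, ‖g r‖ := by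
        rw [← restrict_Ioo_eq_restrict_Icc]
        exact ae_restrict_of_ae_restrict_of_subset (Ioo_subset_Ioo_right ht.2) h
      filter_upwards [h', ae_restrict_mem measurableSet_Icc] with s hs hst
      have hsT : s ∈ Icc 0 T := ⟨hst.1, hst.2.trans ht.2⟩
      have hcs := sq_integral_le hst.1 (hsub hsT hg1) (hsub hsT hg2)
      have hm : s * Y s ≤ T * Y s := mul_le_mul_of_nonneg_right hsT.2 (hY0 s hsT)
      set J := ∫ r in (0 : ℝ)..s, ‖g r‖
      calc ‖g s‖ ^ 2 ≤ (a * ‖w s‖ + b * J) ^ 2 := by gcongr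
        _ ≤ 2 * (a * ‖w s‖) ^ 2 + 2 * (b * J) ^ 2 := by
            nlinarith [sq_nonneg (a * ‖w s‖ - b * J)]
        _ = 2 * a ^ 2 * ‖w s‖ ^ 2 + 2 * b ^ 2 * J ^ 2 := by ring
        _ ≤ 2 * a ^ 2 * ‖w s‖ ^ 2 + 2 * b ^ 2 * (T * Y s) := by
            gcongr; exact hcs.trans hm
        _ = _ := by simp only [β]; ring
    refine hle.trans ?_
    rw [intervalIntegral.integral_add ((hsub ht hw2).const_mul _) ((hsub ht hYi).const_mul _),
      intervalIntegral.integral_const_mul, intervalIntegral.integral_const_mul]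
    refine add_le_add_left (mul_le_mul_of_nonneg_left ?_ (by positivity)) _
    exact intervalIntegral.integral_mono_interval le_rfl ht.1 ht.2
      (Filter.Eventually.of_forall fun s => by positivity) hw2
  have hFc : ContinuousOn F (Icc 0 T) := by
    have := intervalIntegral.continuousOn_primitive_interval' hYi (a := 0) (by simp)
    rwa [uIcc_of_le hT.le] at this
  -- Gronwall is applied to the primitive `F` of `Y`: since `Y` is continuous, `F` has a right
  -- derivative at every point, whereas `Y` is differentiable only almost everywhere.
  have hFT := norm_le_gronwallBound_of_norm_deriv_right_le (f := F) (f' := Y) (δ := 0) (K := β)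
    (ε := α) (a := 0) (b := T) hFc (by
      intro x hx
      have hx' : x ∈ Icc 0 T := ⟨hx.1, hx.2.le⟩
      have hnhds : Icc 0 T ∈ nhdsWithin x (Ici x) :=
        Filter.mem_of_superset (Icc_mem_nhdsGE hx.2) (Icc_subset_Icc_left hx.1)
      have hnhds' : Icc 0 T ∈ nhdsWithin x (Ioi x) := nhdsWithin_mono _ Ioi_subset_Ici_self hnhds
      refine intervalIntegral.integral_hasDerivWithinAt_right (hsub hx' hYi) ?_ ?_
      · exact ⟨Icc 0 T, hnhds', hYc.aestronglyMeasurable measurableSet_Icc⟩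
      · exact ((hYc x hx').mono_of_mem_nhdsWithin hnhds').mono (by simp))
    (by simp [F]) (by
      intro x hx
      have hx' : x ∈ Icc 0 T := ⟨hx.1, hx.2.le⟩
      rw [Real.norm_of_nonneg (hY0 x hx')]
      have hF0 : 0 ≤ F x := intervalIntegral.integral_nonneg hx.1 fun s hs =>
        hY0 s ⟨hs.1, hs.2.trans hx'.2⟩
      rw [Real.norm_of_nonneg hF0]
      linarith [hYF x hx']) T ⟨hT.le, le_rfl⟩
  rw [gronwallBound_of_K_ne_0 hβ.ne'] at hFT
  have hYT : Y T ≤ α * Real.exp (β * T) := by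
    have h1 := hYF T ⟨hT.le, le_rfl⟩
    have h2 : β * F T ≤ β * (α / β * (Real.exp (β * T) - 1)) := by
      gcongr
      refine (le_abs_self _).trans ?_
      simpa using hFT
    have h3 : β * (α / β * (Real.exp (β * T) - 1)) = α * Real.exp (β * T) - α := by
      field_simp
    linarith
  rw [eLpNorm_two_eq_ofReal_sqrt hT.le hg, eLpNorm_two_eq_ofReal_sqrt hT.le hw,
    volterraConst, ← ENNReal.ofReal_mul (Real.sqrt_nonneg _), ← Real.sqrt_mul (by positivity)]
  refine ENNReal.ofReal_le_ofReal (Real.sqrt_le_sqrt (hYT.trans_eq ?_))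
  simp only [α, β, hW]
  ring

/-! ### Functions of class `H²` of one variable -/

lemma IsH2.congr {X : Type*} [NormedAddCommGroup X] [NormedSpace ℝ X] {T : ℝ} {u u' v w : ℝ → X}
    (hT : 0 ≤ T) (h : IsH2 T u v w) (huu' : ∀ t ∈ Icc 0 T, u' t = u t) : IsH2 T u' v w :=
  ⟨h.memLp, fun t ht => by rw [huu' t ht, huu' 0 ⟨le_rfl, hT⟩]; exact h.eq_integral t ht,
    h.deriv_eq_integral⟩

/-- Lebesgue's differentiation theorem: almost everywhere `w` is the derivative of its primitive. -/
lemma ae_eq_zero_of_integral_eq_zero {X : Type*} [NormedAddCommGroup X] [NormedSpace ℝ X]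
    [CompleteSpace X] {T : ℝ} (hT : 0 ≤ T) {w : ℝ → X} (hw : IntervalIntegrable w volume 0 T)
    (h : ∀ t ∈ Ioo 0 T, ∫ s in (0 : ℝ)..t, w s = 0) :
    w =ᵐ[volume.restrict (Ioo 0 T)] 0 := by
  rw [Filter.EventuallyEq, ae_restrict_iff' measurableSet_Ioo]
  filter_upwards [hw.ae_hasDerivAt_integral] with t hd ht
  have h1 := hd (by rw [uIcc_of_le hT]; exact Ioo_subset_Icc_self ht) 0 (by simp)
  refine h1.unique ((hasDerivAt_const t (0 : X)).congr_of_eventuallyEq ?_)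
  filter_upwards [Ioo_mem_nhds ht.1 ht.2] with s hs using h s hs

lemma IsH2.intervalIntegrable {X : Type*} [NormedAddCommGroup X] [NormedSpace ℝ X] {T : ℝ}
    (hT : 0 ≤ T) {u v w : ℝ → X} (h : IsH2 T u v w) : IntervalIntegrable w volume 0 T := by
  rw [intervalIntegrable_iff_integrableOn_Ioo_of_le hT]
  exact h.memLp.integrable (by norm_num)

lemma IsH2.continuousOn_deriv {X : Type*} [NormedAddCommGroup X] [NormedSpace ℝ X] {T : ℝ}
    (hT : 0 ≤ T) {u v w : ℝ → X} (h : IsH2 T u v w) : ContinuousOn v (Icc 0 T) := by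
  have := intervalIntegral.continuousOn_primitive_interval' (h.intervalIntegrable hT) (a := 0)
    (by simp)
  rw [uIcc_of_le hT] at this
  exact (continuousOn_const.add this).congr h.deriv_eq_integral

/-- The second derivative of zero is zero. -/
lemma IsH2.ae_eq_zero {X : Type*} [NormedAddCommGroup X] [NormedSpace ℝ X] [CompleteSpace X]
    {T : ℝ} (hT : 0 < T) {u v w : ℝ → X} (h : IsH2 T u v w) (h0 : u 0 = 0)
    (hu : ∀ t ∈ Ioo 0 T, u t = 0) : w =ᵐ[volume.restrict (Ioo 0 T)] 0 := by
  have hvc := h.continuousOn_deriv hT.le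
  have hv : IntervalIntegrable v volume 0 T :=
    ContinuousOn.intervalIntegrable (by rwa [uIcc_of_le hT.le])
  have hv0 : v =ᵐ[volume.restrict (Ioo 0 T)] 0 :=
    ae_eq_zero_of_integral_eq_zero hT.le hv fun t ht => by
      have := h.eq_integral t (Ioo_subset_Icc_self ht)
      rw [hu t ht, h0, zero_add] at this
      exact this.symm
  -- Continuity upgrades the vanishing of `v` from almost everywhere to everywhere, including `t =
  -- 0`, whose value enters the formula for `v` as a primitive of `w`.
  have hv1 : EqOn v 0 (Icc 0 T) := by
    rw [restrict_Ioo_eq_restrict_Icc] at hv0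
    exact Measure.eqOn_Icc_of_ae_eq volume hT.ne hv0 hvc continuousOn_const
  refine ae_eq_zero_of_integral_eq_zero hT.le (h.intervalIntegrable hT.le) fun t ht => ?_
  have := h.deriv_eq_integral t (Ioo_subset_Icc_self ht)
  rw [hv1 (Ioo_subset_Icc_self ht), hv1 ⟨le_rfl, hT.le⟩] at this
  simpa using this.symm

end Lame

namespace Lame

/-! ### The fundamental solution of the Lamé system in Fourier variables -/

/-- The symbol `ξ_i ξ_j / |ξ|²` of the projection to longitudinal fields. -/
noncomputable def proj (i j : Fin 3) (ξ : Space) : ℝ := ξ i * ξ j / ‖ξ‖ ^ 2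

/-- The symbol of the projection to transverse fields. -/
noncomputable def coproj (i j : Fin 3) (ξ : Space) : ℝ := (if i = j then 1 else 0) - proj i j ξ

/-- The fundamental solution, with wave speeds given by `a` and `b`. -/
noncomputable def kern (a b : ℝ) (i j : Fin 3) (τ : ℝ) (ξ : Space) : ℝ :=
  proj i j ξ * (Real.sin (a * ‖ξ‖ * τ) / (a * ‖ξ‖)) +
    coproj i j ξ * (Real.sin (b * ‖ξ‖ * τ) / (b * ‖ξ‖))

/-- The first time derivative of `kern`. -/
noncomputable def kernDeriv (a b : ℝ) (i j : Fin 3) (τ : ℝ) (ξ : Space) : ℝ :=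
  proj i j ξ * Real.cos (a * ‖ξ‖ * τ) + coproj i j ξ * Real.cos (b * ‖ξ‖ * τ)

/-- The second time derivative of `kern`. -/
noncomputable def kernDeriv2 (a b : ℝ) (i j : Fin 3) (τ : ℝ) (ξ : Space) : ℝ :=
  proj i j ξ * (-Real.sin (a * ‖ξ‖ * τ) * (a * ‖ξ‖)) +
    coproj i j ξ * (-Real.sin (b * ‖ξ‖ * τ) * (b * ‖ξ‖))

lemma abs_proj_le (i j : Fin 3) (ξ : Space) : |proj i j ξ| ≤ 1 := by
  rw [proj, abs_div, abs_mul, abs_of_nonneg (sq_nonneg ‖ξ‖)]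
  refine div_le_one_of_le₀ ?_ (sq_nonneg _)
  rw [sq]
  exact mul_le_mul (PiLp.norm_apply_le ξ i) (PiLp.norm_apply_le ξ j) (abs_nonneg _) (norm_nonneg _)

lemma abs_coproj_le (i j : Fin 3) (ξ : Space) : |coproj i j ξ| ≤ 2 := by
  have h := abs_le.1 (abs_proj_le i j ξ)
  rw [coproj, abs_le]
  split_ifs <;> constructor <;> linarith [h.1, h.2]

lemma abs_proj_mul_add_le (i j : Fin 3) (ξ : Space) {x y m n : ℝ} (hx : |x| ≤ m) (hy : |y| ≤ n) :
    |proj i j ξ * x + coproj i j ξ * y| ≤ m + 2 * n := by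
  have h1 : |proj i j ξ * x| ≤ 1 * m := by
    rw [abs_mul]; exact mul_le_mul (abs_proj_le i j ξ) hx (abs_nonneg _) zero_le_one
  have h2 : |coproj i j ξ * y| ≤ 2 * n := by
    rw [abs_mul]; exact mul_le_mul (abs_coproj_le i j ξ) hy (abs_nonneg _) zero_le_two
  linarith [abs_add_le (proj i j ξ * x) (coproj i j ξ * y)]

/-- Uniform in the frequency `c`; it includes `c = 0`, where the quotient is 0 by convention. -/
lemma abs_sin_mul_div_le (c τ : ℝ) : |Real.sin (c * τ) / c| ≤ |τ| := by
  rw [abs_div]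
  refine div_le_of_le_mul₀ (abs_nonneg _) (abs_nonneg _) ?_
  rw [mul_comm |τ|, ← abs_mul]
  exact Real.abs_sin_le_abs

variable {a b : ℝ} {i j : Fin 3}

lemma abs_kern_le (τ : ℝ) (ξ : Space) : |kern a b i j τ ξ| ≤ 3 * |τ| :=
  (abs_proj_mul_add_le i j ξ (abs_sin_mul_div_le _ τ) (abs_sin_mul_div_le _ τ)).trans_eq (by ring)

lemma abs_kernDeriv_le (τ : ℝ) (ξ : Space) : |kernDeriv a b i j τ ξ| ≤ 3 :=
  (abs_proj_mul_add_le i j ξ (Real.abs_cos_le_one _) (Real.abs_cos_le_one _)).trans_eq (by norm_num)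

lemma abs_neg_sin_mul_le (ha : 0 ≤ a) (x : ℝ) (ξ : Space) :
    |-Real.sin x * (a * ‖ξ‖)| ≤ a * ‖ξ‖ := by
  rw [abs_mul, abs_neg, abs_of_nonneg (by positivity : 0 ≤ a * ‖ξ‖)]
  exact mul_le_of_le_one_left (by positivity) (Real.abs_sin_le_one x)

lemma abs_kernDeriv2_le (ha : 0 ≤ a) (hb : 0 ≤ b) (τ : ℝ) (ξ : Space) :
    |kernDeriv2 a b i j τ ξ| ≤ (a + 2 * b) * ‖ξ‖ :=
  (abs_proj_mul_add_le i j ξ (abs_neg_sin_mul_le ha _ ξ) (abs_neg_sin_mul_le hb _ ξ)).trans_eq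
    (by ring)

lemma measurable_proj : Measurable (proj i j) := by
  unfold proj; fun_prop

lemma measurable_coproj : Measurable (coproj i j) := measurable_const.sub measurable_proj

lemma measurable_kern : Measurable fun q : ℝ × Space => kern a b i j q.1 q.2 := by
  have h1 := (measurable_proj (i := i) (j := j)).comp (measurable_snd : Measurable (Prod.snd : ℝ × Space → Space))
  have h2 := (measurable_coproj (i := i) (j := j)).comp (measurable_snd : Measurable (Prod.snd : ℝ × Space → Space))
  unfold kern
  exact (h1.mul (by fun_prop)).add (h2.mul (by fun_prop))

lemma measurable_kernDeriv (τ : ℝ) : Measurable (kernDeriv a b i j τ) := by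
  have h1 := measurable_proj (i := i) (j := j)
  have h2 := measurable_coproj (i := i) (j := j)
  unfold kernDeriv
  exact (h1.mul (by fun_prop)).add (h2.mul (by fun_prop))

lemma measurable_kernDeriv2 (τ : ℝ) : Measurable (kernDeriv2 a b i j τ) := by
  have h1 := measurable_proj (i := i) (j := j)
  have h2 := measurable_coproj (i := i) (j := j)
  unfold kernDeriv2
  exact (h1.mul (by fun_prop)).add (h2.mul (by fun_prop))

@[simp] lemma kern_zero (ξ : Space) : kern a b i j 0 ξ = 0 := by simp [kern]

-- The two projections add up to the identity at every `ξ`, even at `ξ = 0`. This makes `κ'(0)` a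
-- multiple of the identity matrix.
@[simp] lemma kernDeriv_zero (ξ : Space) : kernDeriv a b i j 0 ξ = if i = j then 1 else 0 := by
  simp [kernDeriv, coproj]

/-- At `ξ = 0` the statement fails for `i = j`: there `kern` is 0 by the convention for division,
while `kernDeriv` is 1. A single point is negligible under the integral. -/
lemma hasDerivAt_kern (ha : a ≠ 0) (hb : b ≠ 0) {ξ : Space} (hξ : ξ ≠ 0) (τ : ℝ) :
    HasDerivAt (fun τ => kern a b i j τ ξ) (kernDeriv a b i j τ ξ) τ := by
  have h : ∀ {c : ℝ}, c ≠ 0 →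
      HasDerivAt (fun τ => Real.sin (c * ‖ξ‖ * τ) / (c * ‖ξ‖)) (Real.cos (c * ‖ξ‖ * τ)) τ := by
    intro c hc
    have hc' : c * ‖ξ‖ ≠ 0 := mul_ne_zero hc (norm_ne_zero_iff.2 hξ)
    have h := (((hasDerivAt_id τ).const_mul (c * ‖ξ‖)).sin).div_const (c * ‖ξ‖)
    simpa [hc'] using h
  exact ((h ha).const_mul _).add ((h hb).const_mul _)

lemma hasDerivAt_kernDeriv (ξ : Space) (τ : ℝ) :
    HasDerivAt (fun τ => kernDeriv a b i j τ ξ) (kernDeriv2 a b i j τ ξ) τ := by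
  have h : ∀ c : ℝ,
      HasDerivAt (fun τ => Real.cos (c * ‖ξ‖ * τ)) (-Real.sin (c * ‖ξ‖ * τ) * (c * ‖ξ‖)) τ := by
    intro c
    simpa using ((hasDerivAt_id τ).const_mul (c * ‖ξ‖)).cos
  exact ((h a).const_mul _).add ((h b).const_mul _)

lemma continuous_kernDeriv2 (ξ : Space) : Continuous fun τ => kernDeriv2 a b i j τ ξ := by
  unfold kernDeriv2; fun_prop

/-! ### Integrals of the fundamental solution -/

/-- The integral of a time dependent symbol against a weight. -/
noncomputable def symbolIntegral (k : ℝ → Space → ℝ) (ω : Space → ℂ) (τ : ℝ) : ℂ :=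
  ∫ ξ, (k τ ξ : ℂ) * ω ξ

variable {ω : Space → ℂ}

lemma aestronglyMeasurable_symbol_mul {k : Space → ℝ} (hk : Measurable k)
    (hω : AEStronglyMeasurable ω volume) :
    AEStronglyMeasurable (fun ξ => (k ξ : ℂ) * ω ξ) volume :=
  (Complex.measurable_ofReal.comp hk).aestronglyMeasurable.mul hω

lemma norm_symbol_mul_le {x B : ℝ} {z : ℂ} (h : |x| ≤ B) : ‖(x : ℂ) * z‖ ≤ B * ‖z‖ := by
  rw [norm_mul, Complex.norm_real]
  exact mul_le_mul_of_nonneg_right h (norm_nonneg _)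

/-- Differentiation under the integral sign; the majorant does not depend on `τ`, so no localization
in time is needed. -/
lemma hasDerivAt_symbolIntegral {k k' : ℝ → Space → ℝ} {B : Space → ℝ}
    (hω : AEStronglyMeasurable ω volume) (hk : ∀ τ, Measurable (k τ)) (hk' : ∀ τ, Measurable (k' τ))
    (hB : ∀ τ ξ, |k' τ ξ| ≤ B ξ) (hBω : Integrable fun ξ => B ξ * ‖ω ξ‖)
    (hint : ∀ τ, Integrable fun ξ => (k τ ξ : ℂ) * ω ξ)
    (hd : ∀ᵐ ξ, ∀ τ, HasDerivAt (fun τ => k τ ξ) (k' τ ξ) τ) (τ : ℝ) :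
    HasDerivAt (symbolIntegral k ω) (symbolIntegral k' ω τ) τ := by
  refine (hasDerivAt_integral_of_dominated_loc_of_deriv_le (F := fun τ ξ => (k τ ξ : ℂ) * ω ξ)
    (F' := fun τ ξ => (k' τ ξ : ℂ) * ω ξ) (bound := fun ξ => B ξ * ‖ω ξ‖) Filter.univ_mem
    (Filter.Eventually.of_forall fun τ => aestronglyMeasurable_symbol_mul (hk τ) hω) (hint τ)
    (aestronglyMeasurable_symbol_mul (hk' τ) hω)
    (Filter.Eventually.of_forall fun ξ τ _ => norm_symbol_mul_le (hB τ ξ)) hBω ?_).2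
  filter_upwards [hd] with ξ hξ τ _
  exact ((hξ τ).ofReal_comp).mul_const _

lemma integrable_kern_mul (hω : Integrable ω) (τ : ℝ) :
    Integrable fun ξ => (kern a b i j τ ξ : ℂ) * ω ξ :=
  (hω.norm.const_mul (3 * |τ|)).mono' (aestronglyMeasurable_symbol_mul
    (measurable_kern.comp measurable_prodMk_left) hω.1)
    (Filter.Eventually.of_forall fun ξ => norm_symbol_mul_le (abs_kern_le τ ξ))

lemma hasDerivAt_kernIntegral (ha : a ≠ 0) (hb : b ≠ 0) (hω : Integrable ω) (τ : ℝ) :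
    HasDerivAt (symbolIntegral (kern a b i j) ω) (symbolIntegral (kernDeriv a b i j) ω τ) τ := by
  refine hasDerivAt_symbolIntegral hω.1 (fun τ => measurable_kern.comp measurable_prodMk_left)
    measurable_kernDeriv abs_kernDeriv_le (hω.norm.const_mul 3) (integrable_kern_mul hω) ?_ τ
  filter_upwards [compl_mem_ae_iff.2 (measure_singleton (0 : Space))] with ξ hξ τ
  exact hasDerivAt_kern ha hb hξ τ

/-- The second time derivative grows like `|ξ|`, so this is where integrability of `|ξ| ω` is spent.
-/
lemma hasDerivAt_kernDerivIntegral (ha : 0 ≤ a) (hb : 0 ≤ b) (hω : Integrable ω)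
    (hω1 : Integrable fun ξ => ‖ξ‖ * ‖ω ξ‖) (τ : ℝ) :
    HasDerivAt (symbolIntegral (kernDeriv a b i j) ω) (symbolIntegral (kernDeriv2 a b i j) ω τ)
      τ := by
  refine hasDerivAt_symbolIntegral hω.1 measurable_kernDeriv measurable_kernDeriv2
    (abs_kernDeriv2_le ha hb) ?_ (fun τ => ?_)
    (Filter.Eventually.of_forall fun ξ => hasDerivAt_kernDeriv ξ) τ
  · simpa only [mul_assoc] using hω1.const_mul (a + 2 * b)
  · exact (hω.norm.const_mul 3).mono' (aestronglyMeasurable_symbol_mul (measurable_kernDeriv τ) hω.1)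
      (Filter.Eventually.of_forall fun ξ => norm_symbol_mul_le (abs_kernDeriv_le τ ξ))

lemma continuous_kernDeriv2Integral (ha : 0 ≤ a) (hb : 0 ≤ b) (hω : AEStronglyMeasurable ω volume)
    (hω1 : Integrable fun ξ => ‖ξ‖ * ‖ω ξ‖) :
    Continuous (symbolIntegral (kernDeriv2 a b i j) ω) := by
  refine continuous_of_dominated (F := fun τ ξ => (kernDeriv2 a b i j τ ξ : ℂ) * ω ξ)
    (bound := fun ξ => (a + 2 * b) * (‖ξ‖ * ‖ω ξ‖))
    (fun τ => aestronglyMeasurable_symbol_mul (measurable_kernDeriv2 τ) hω)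
    (fun τ => Filter.Eventually.of_forall fun ξ => ?_) (hω1.const_mul _)
    (Filter.Eventually.of_forall fun ξ => ?_)
  · rw [← mul_assoc]
    exact norm_symbol_mul_le (abs_kernDeriv2_le ha hb τ ξ)
  · exact (Complex.continuous_ofReal.comp (continuous_kernDeriv2 ξ)).mul continuous_const

lemma norm_kernDeriv2Integral_le (ha : 0 ≤ a) (hb : 0 ≤ b)
    (hω1 : Integrable fun ξ => ‖ξ‖ * ‖ω ξ‖) (τ : ℝ) :
    ‖symbolIntegral (kernDeriv2 a b i j) ω τ‖ ≤ (a + 2 * b) * ∫ ξ, ‖ξ‖ * ‖ω ξ‖ := by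
  rw [← integral_const_mul]
  refine norm_integral_le_of_norm_le (hω1.const_mul _) (Filter.Eventually.of_forall fun ξ => ?_)
  rw [← mul_assoc]
  exact norm_symbol_mul_le (abs_kernDeriv2_le ha hb τ ξ)

lemma norm_kernIntegral_le (hω : Integrable ω) (τ : ℝ) :
    ‖symbolIntegral (kern a b i j) ω τ‖ ≤ 3 * |τ| * ∫ ξ, ‖ω ξ‖ := by
  rw [← integral_const_mul]
  exact norm_integral_le_of_norm_le (hω.norm.const_mul _)
    (Filter.Eventually.of_forall fun ξ => norm_symbol_mul_le (abs_kern_le τ ξ))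

@[simp] lemma kernIntegral_zero : symbolIntegral (kern a b i j) ω 0 = 0 := by
  simp [symbolIntegral]

@[simp] lemma kernDerivIntegral_zero :
    symbolIntegral (kernDeriv a b i j) ω 0 = if i = j then ∫ ξ, ω ξ else 0 := by
  split_ifs with h <;> simp [symbolIntegral, h]

/-! ### Exchanging the order of integration -/

lemma integrable_kern_prod {g : ℝ → ℂ} {t : ℝ} (hg : IntegrableOn g (Ioc 0 t)) (hω : Integrable ω) :
    Integrable (fun q : ℝ × Space => (kern a b i j (t - q.1) q.2 : ℂ) * (g q.1 * ω q.2))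
      ((volume.restrict (Ioc 0 t)).prod volume) := by
  refine (hg.mul_prod hω).bdd_mul (c := 3 * |t|) ?_ ?_
  · have h : Measurable fun q : ℝ × Space => kern a b i j (t - q.1) q.2 :=
      (measurable_kern (a := a) (b := b) (i := i) (j := j)).comp
        (by fun_prop : Measurable fun q : ℝ × Space => ((t - q.1, q.2) : ℝ × Space))
    exact (Complex.measurable_ofReal.comp h).aestronglyMeasurable
  · have h : ∀ᵐ q ∂(volume.restrict (Ioc 0 t)).prod (volume : Measure Space), q.1 ∈ Ioc 0 t :=
      Measure.quasiMeasurePreserving_fst.ae (ae_restrict_mem measurableSet_Ioc)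
    filter_upwards [h] with q hq
    rw [Complex.norm_real]
    refine (abs_kern_le _ _).trans ?_
    rw [abs_of_nonneg (by linarith [hq.2]), abs_of_nonneg (hq.1.le.trans hq.2)]
    linarith [hq.1]

lemma integrable_mul_conv_kern {g : ℝ → ℂ} {t : ℝ} (ht : 0 ≤ t)
    (hg : IntervalIntegrable g volume 0 t) (hω : Integrable ω) :
    Integrable fun ξ => ω ξ * ∫ s in (0 : ℝ)..t, (kern a b i j (t - s) ξ : ℂ) * g s := by
  rw [intervalIntegrable_iff_integrableOn_Ioc_of_le ht] at hg
  refine (integrable_kern_prod (a := a) (b := b) (i := i) (j := j) hg hω).integral_prod_right.congr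
    (Filter.Eventually.of_forall fun ξ => ?_)
  simp only
  rw [intervalIntegral.integral_of_le ht, ← integral_const_mul]
  exact integral_congr_ae (Filter.Eventually.of_forall fun s => by ring)

lemma integral_mul_conv_kern {g : ℝ → ℂ} {t : ℝ} (ht : 0 ≤ t)
    (hg : IntervalIntegrable g volume 0 t) (hω : Integrable ω) :
    ∫ ξ, ω ξ * ∫ s in (0 : ℝ)..t, (kern a b i j (t - s) ξ : ℂ) * g s =
      ∫ s in (0 : ℝ)..t, symbolIntegral (kern a b i j) ω (t - s) * g s := by
  rw [intervalIntegrable_iff_integrableOn_Ioc_of_le ht] at hg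
  have h := integral_integral_swap (f := fun s ξ => (kern a b i j (t - s) ξ : ℂ) * (g s * ω ξ))
    (integrable_kern_prod hg hω)
  rw [intervalIntegral.integral_of_le ht]
  calc _ = ∫ ξ, ∫ s in Ioc 0 t, (kern a b i j (t - s) ξ : ℂ) * (g s * ω ξ) := by
        refine integral_congr_ae (Filter.Eventually.of_forall fun ξ => ?_)
        simp only
        rw [intervalIntegral.integral_of_le ht, ← integral_const_mul]
        exact integral_congr_ae (Filter.Eventually.of_forall fun s => by ring)
    _ = _ := by
        rw [← h]
        refine integral_congr_ae (Filter.Eventually.of_forall fun s => ?_)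
        simp only [symbolIntegral]
        rw [← integral_mul_const]
        exact integral_congr_ae (Filter.Eventually.of_forall fun ξ => by ring)

end Lame

namespace Lame

open FourierTransform

/-! ### The Fourier transform of integrable and of square integrable functions -/

lemma integral_fourier_mul {h : Space → ℂ} (hh : Integrable h) (ψ : 𝓢(Space, ℂ)) :
    ∫ x, 𝓕 ψ x * h x = ∫ ξ, ψ ξ * 𝓕 h ξ := by
  simpa using! VectorFourier.integral_fourierIntegral_smul_eq_flip (L := innerₗ Space)
    Real.continuous_fourierChar continuous_inner (ψ.integrable (μ := volume)) hh

lemma integral_fourierInv_mul {h : Space → ℂ} (hh : Integrable h) (ψ : 𝓢(Space, ℂ)) :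
    ∫ x, 𝓕⁻ ψ x * h x = ∫ ξ, ψ ξ * 𝓕⁻ h ξ := by
  -- The inverse transform is the Fourier integral for the form `-⟨·,·⟩`, which is again symmetric.
  have hflip : (-innerₗ Space).flip = -innerₗ Space := by
    ext x y; simp [real_inner_comm]
  have h1 := VectorFourier.integral_fourierIntegral_smul_eq_flip (L := -innerₗ Space)
    Real.continuous_fourierChar (by simpa using! continuous_inner.neg) (ψ.integrable (μ := volume)) hh
  rw [hflip] at h1
  simp_rw [SchwartzMap.fourierInv_coe]
  exact h1

lemma fourierInv_eq_integral (h : Space → ℂ) (x : Space) :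
    𝓕⁻ h x = ∫ ξ, Complex.exp ((2 * Real.pi * inner ℝ ξ x : ℝ) * Complex.I) * h ξ := by
  rw [Real.fourierInv_eq']
  simp

/-- Two locally integrable functions with the same integrals against compactly supported Schwartz
functions agree almost everywhere. -/
lemma ae_eq_of_integral_schwartz_mul_eq {h h' : Space → ℂ} (hh : LocallyIntegrable h volume)
    (hh' : LocallyIntegrable h' volume)
    (H : ∀ ψ : 𝓢(Space, ℂ), HasCompactSupport ψ → ∫ ξ, ψ ξ * h ξ = ∫ ξ, ψ ξ * h' ξ) :
    h =ᵐ[volume] h' := by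
  refine ae_eq_of_integral_contDiff_smul_eq hh hh' fun g hg hgc => ?_
  have h1 : HasCompactSupport (Complex.ofRealCLM ∘ g) := hgc.comp_left rfl
  have h2 : ContDiff ℝ ((⊤ : ℕ∞) : WithTop ℕ∞) (Complex.ofRealCLM ∘ g) := by fun_prop
  simpa using H (h1.toSchwartzMap h2) h1

/-- Test functions of the form `𝓕 ψ` turn pairings with `V` into integrals against its Fourier
transform, so that the support of `ψ` localizes in frequency. -/
lemma toTemperedDistribution_fourier_apply (V : L2) (ψ : 𝓢(Space, ℂ)) :
    (V : 𝓢'(Space, ℂ)) (𝓕 ψ) = ∫ ξ, ψ ξ * (𝓕 V : L2) ξ := by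
  rw [← TemperedDistribution.fourier_apply, Lp.fourier_toTemperedDistribution_eq]
  simp

/-- If the Fourier transform of `V ∈ L²` is represented by an integrable function, then `V` is
represented by the inverse Fourier integral of that function. -/
lemma ae_eq_fourierInv_of_fourier_ae_eq {V : L2} {h : Space → ℂ} (hh : Integrable h)
    (hV : (𝓕 V : L2) =ᵐ[volume] h) : V =ᵐ[volume] 𝓕⁻ h := by
  have hc : Continuous (𝓕⁻ h) :=
    VectorFourier.fourierIntegral_continuous Real.continuous_fourierChar
      (by simpa using! continuous_inner.neg) hh
  refine ae_eq_of_integral_schwartz_mul_eq ((Lp.memLp V).locallyIntegrable (by norm_num))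
    hc.locallyIntegrable fun φ _ => ?_
  have h1 := toTemperedDistribution_fourier_apply V (𝓕⁻ φ)
  rw [FourierTransform.fourier_fourierInv_eq] at h1
  simp only [Lp.toTemperedDistribution_apply, smul_eq_mul] at h1
  rw [h1, ← integral_fourierInv_mul hh]
  refine integral_congr_ae ?_
  filter_upwards [hV] with ξ hξ
  rw [hξ]

lemma norm_eq_sqrt_integral (V : L2) : ‖V‖ = (∫ ξ, ‖V ξ‖ ^ 2) ^ (1 / 2 : ℝ) := by
  have h := (Lp.memLp V).eLpNorm_eq_integral_rpow_norm (by norm_num) (by norm_num)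
  rw [Lp.norm_def, h, ENNReal.toReal_ofReal (by positivity)]
  norm_num

/-! ### The Fourier transform of admissible functions -/

/-- The constant in the embedding of `H^p` into the space of functions `h` with
`∫ |ξ| |𝓕 h(ξ)| dξ < ∞`. -/
noncomputable def sobolevConst (p : ℝ) : ℝ :=
  (∫ ξ : Space, ((1 + ‖ξ‖ ^ 2) ^ ((1 - p) / 2)) ^ (2 : ℝ)) ^ (1 / 2 : ℝ)

/-- The square is `(1 + |ξ|²)^(1 - p)`, integrable on `ℝ³` when `2p - 2 > 3`: the source of the
threshold `5/2`. -/
lemma memLp_bracket {p : ℝ} (hp : 5 / 2 < p) :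
    MemLp (fun ξ : Space => (1 + ‖ξ‖ ^ 2) ^ ((1 - p) / 2)) 2 volume := by
  have hc : Continuous fun ξ : Space => (1 + ‖ξ‖ ^ 2) ^ ((1 - p) / 2) :=
    Continuous.rpow_const (by fun_prop) fun ξ => Or.inl (by positivity)
  rw [memLp_two_iff_integrable_sq hc.aestronglyMeasurable]
  have hi := integrable_rpow_neg_one_add_norm_sq (E := Space) (μ := volume) (r := 2 * p - 2)
    (by simp; linarith)
  refine hi.congr (Filter.Eventually.of_forall fun ξ => ?_)
  simp only
  rw [← Real.rpow_mul_natCast (by positivity)]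
  congr 1
  push_cast
  ring

/-- The support condition serves to make `𝓕 f` a classical, continuous Fourier integral. -/
lemma integrable_of_admissible {x₀ : Space} {p δ M R : ℝ} {f : Space → ℂ}
    (hf : f ∈ admissible x₀ p δ M R) : Integrable f :=
  hf.1.integrable_of_hasCompactSupport <|
    HasCompactSupport.of_support_subset_isCompact (isCompact_closedBall (0 : Space) R)
      ((subset_tsupport f).trans (hf.2.2.2.trans Metric.ball_subset_closedBall))

/-- The Fourier transform of a function in `H^p`, multiplied by the weight, is in `L²`. -/
lemma exists_weight_mul_fourier {p M : ℝ} {f : Space → ℂ} (hf : Integrable f)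
    (hs : SobolevNormLE p f M) :
    ∃ b : L2, ‖b‖ ≤ M ∧ (fun ξ => (((1 + ‖ξ‖ ^ 2) ^ (p / 2) : ℝ) : ℂ) * 𝓕 f ξ) =ᵐ[volume] b := by
  obtain ⟨hL, b, hb, hbM⟩ := hs
  refine ⟨𝓕 b, by simpa using hbM, ?_⟩
  have hfc : Continuous (𝓕 f) :=
    VectorFourier.fourierIntegral_continuous Real.continuous_fourierChar
      (by simpa using! continuous_inner) hf
  have hm : Continuous fun ξ : Space => (((1 + ‖ξ‖ ^ 2) ^ (p / 2) : ℝ) : ℂ) :=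
    Complex.continuous_ofReal.comp
      (Continuous.rpow_const (by fun_prop) fun ξ => Or.inl (by positivity))
  refine ae_eq_of_integral_schwartz_mul_eq (hm.mul hfc).locallyIntegrable
    ((Lp.memLp _).locallyIntegrable (by norm_num)) fun ψ _ => ?_
  have h1 := congrArg (fun u : 𝓢'(Space, ℂ) => (𝓕 u) ψ) hb
  simp only [TemperedDistribution.fourier_besselPotential_eq_smulLeftCLM_fourier_apply,
    Lp.fourier_toTemperedDistribution_eq b, TemperedDistribution.smulLeftCLM_apply_apply,
    TemperedDistribution.fourier_apply, Lp.toTemperedDistribution_apply, smul_eq_mul] at h1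
  have h2 : ∀ φ : 𝓢(Space, ℂ), ∫ x, φ x * hL.toLp f x = ∫ x, φ x * f x := fun φ =>
    integral_congr_ae (by filter_upwards [hL.coeFn_toLp] with x hx; rw [hx])
  rw [← h1, h2, integral_fourier_mul hf]
  refine integral_congr_ae (Filter.Eventually.of_forall fun ξ => ?_)
  simp only
  rw [SchwartzMap.smulLeftCLM_apply_apply (by fun_prop), smul_eq_mul]
  ring

/-- The bound of the weighted `L¹` norm of the Fourier transform by the `H^p` norm, `p > 5/2`. -/
lemma fourier_of_sobolevNormLE {p M : ℝ} (hp : 5 / 2 < p) {f : Space → ℂ} (hf : Integrable f)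
    (hs : SobolevNormLE p f M) :
    Integrable (𝓕 f) ∧ Integrable (fun ξ => ‖ξ‖ * ‖𝓕 f ξ‖) ∧
      ∫ ξ, ‖ξ‖ * ‖𝓕 f ξ‖ ≤ sobolevConst p * M := by
  obtain ⟨b, hbM, hb⟩ := exists_weight_mul_fourier hf hs
  have hfc : Continuous (𝓕 f) :=
    VectorFourier.fourierIntegral_continuous Real.continuous_fourierChar
      (by simpa using! continuous_inner) hf
  have hw := memLp_bracket hp
  have hbn : MemLp (fun ξ => ‖b ξ‖) 2 volume := (Lp.memLp b).norm
  have hwb : Integrable fun ξ : Space => (1 + ‖ξ‖ ^ 2) ^ ((1 - p) / 2) * ‖b ξ‖ :=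
    hw.integrable_mul hbn
  -- Both `1` and `|ξ|` are at most `(1 + |ξ|²)^(1/2)`, so this one identity yields the majorants of
  -- `𝓕 f` and of `|ξ| 𝓕 f`.
  have key : ∀ᵐ ξ : Space, (1 + ‖ξ‖ ^ 2) ^ (1 / 2 : ℝ) * ‖𝓕 f ξ‖ =
      (1 + ‖ξ‖ ^ 2) ^ ((1 - p) / 2) * ‖b ξ‖ := by
    filter_upwards [hb] with ξ hξ
    rw [← hξ, norm_mul, Complex.norm_real, Real.norm_of_nonneg (by positivity), ← mul_assoc,
      ← Real.rpow_add (by positivity)]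
    congr 2
    ring
  have hsq : ∀ ξ : Space, (1 + ‖ξ‖ ^ 2) ^ (1 / 2 : ℝ) = Real.sqrt (1 + ‖ξ‖ ^ 2) := fun ξ =>
    (Real.sqrt_eq_rpow _).symm
  have h1 : ∀ᵐ ξ : Space, ‖𝓕 f ξ‖ ≤ (1 + ‖ξ‖ ^ 2) ^ ((1 - p) / 2) * ‖b ξ‖ := by
    filter_upwards [key] with ξ hξ
    rw [← hξ, hsq]
    exact le_mul_of_one_le_left (norm_nonneg _)
      (Real.one_le_sqrt.2 (by linarith [sq_nonneg ‖ξ‖]))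
  have h2 : ∀ᵐ ξ : Space, ‖ξ‖ * ‖𝓕 f ξ‖ ≤ (1 + ‖ξ‖ ^ 2) ^ ((1 - p) / 2) * ‖b ξ‖ := by
    filter_upwards [key] with ξ hξ
    rw [← hξ, hsq]
    exact mul_le_mul_of_nonneg_right (Real.le_sqrt_of_sq_le (by linarith)) (norm_nonneg _)
  have h3 : Integrable fun ξ => ‖ξ‖ * ‖𝓕 f ξ‖ := by
    refine hwb.mono' (continuous_norm.mul hfc.norm).aestronglyMeasurable ?_
    filter_upwards [h2] with ξ hξ
    rwa [Real.norm_of_nonneg (by positivity)]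
  refine ⟨hwb.mono' hfc.aestronglyMeasurable h1, h3, ?_⟩
  have hcs := integral_mul_le_Lp_mul_Lq_of_nonneg (μ := (volume : Measure Space))
    Real.HolderConjugate.two_two
    (f := fun ξ : Space => (1 + ‖ξ‖ ^ 2) ^ ((1 - p) / 2)) (g := fun ξ => ‖b ξ‖)
    (Filter.Eventually.of_forall fun ξ => by positivity)
    (Filter.Eventually.of_forall fun ξ => norm_nonneg _) (by simpa using hw) (by simpa using hbn)
  refine (integral_mono_ae h3 hwb h2).trans (hcs.trans ?_)
  rw [sobolevConst]
  refine mul_le_mul_of_nonneg_left ?_ (by positivity)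
  refine le_trans (le_of_eq ?_) hbM
  rw [norm_eq_sqrt_integral]
  norm_num

/-! ### The Lamé operator in Fourier variables -/

/-- Multiplication of Schwartz functions by the coordinate `ξ_j`. -/
noncomputable def mulCoord (j : Fin 3) (ψ : 𝓢(Space, ℂ)) : 𝓢(Space, ℂ) :=
  SchwartzMap.smulLeftCLM ℂ (inner ℝ · (EuclideanSpace.single j (1 : ℝ) : Space)) ψ

@[simp] lemma mulCoord_apply (j : Fin 3) (ψ : 𝓢(Space, ℂ)) (ξ : Space) :
    mulCoord j ψ ξ = (ξ j : ℂ) * ψ ξ := by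
  rw [mulCoord, SchwartzMap.smulLeftCLM_apply_apply (by fun_prop)]
  simp [EuclideanSpace.inner_single_right]

/-- The sign from the distributional derivative cancels the one in `∂_j 𝓕 ψ = -2πi 𝓕(ξ_j ψ)`. -/
lemma partialDeriv_fourier (j : Fin 3) (u : 𝓢'(Space, ℂ)) (ψ : 𝓢(Space, ℂ)) :
    partialDeriv j u (𝓕 ψ) = 2 * Real.pi * Complex.I * u (𝓕 (mulCoord j ψ)) := by
  rw [partialDeriv, TemperedDistribution.lineDerivOp_apply_apply,
    SchwartzMap.lineDerivOp_fourier_eq, ← mulCoord]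
  simp

lemma divStress_fourier (lam mu : ℝ) (u : Fin 3 → 𝓢'(Space, ℂ)) (i : Fin 3) (ψ : 𝓢(Space, ℂ)) :
    divStress lam mu u i (𝓕 ψ) = -(4 * Real.pi ^ 2) * ∑ j, ∑ k, ∑ l,
      (stiffness lam mu i j k l : ℂ) * u k (𝓕 (mulCoord l (mulCoord j ψ))) := by
  simp only [divStress, _root_.sum_apply, partialDeriv_fourier, stress,
    _root_.smul_apply, smul_eq_mul, Finset.mul_sum]
  refine Finset.sum_congr rfl fun j _ => Finset.sum_congr rfl fun k _ =>
    Finset.sum_congr rfl fun l _ => ?_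
  linear_combination (4 * (Real.pi : ℂ) ^ 2 * (stiffness lam mu i j k l : ℂ) *
    u k (𝓕 (mulCoord l (mulCoord j ψ)))) * Complex.I_sq

/-- The Lamé operator, divided by `-rho`, in Fourier variables and acting on test functions. -/
noncomputable def lameOp (rho lam mu : ℝ) (ψ : Fin 3 → 𝓢(Space, ℂ)) (k : Fin 3) : 𝓢(Space, ℂ) :=
  ∑ i, ∑ j, ∑ l, ((4 * Real.pi ^ 2 / rho * stiffness lam mu i j k l : ℝ) : ℂ) •
    mulCoord l (mulCoord j (ψ i))

/-- Summing over the components moves the operator from `u` to the vector test function, so that the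
weak equation becomes a relation between pairings with `ψ` and with `lameOp ψ`. -/
lemma sum_divStress_fourier {rho : ℝ} (hrho : rho ≠ 0) (lam mu : ℝ) (u : Fin 3 → 𝓢'(Space, ℂ))
    (ψ : Fin 3 → 𝓢(Space, ℂ)) :
    ∑ i, divStress lam mu u i (𝓕 (ψ i)) = -rho * ∑ k, u k (𝓕 (lameOp rho lam mu ψ k)) := by
  have hF : ∀ φ : 𝓢(Space, ℂ), 𝓕 φ = fourierCLM ℂ 𝓢(Space, ℂ) φ := fun φ => rfl
  have hr : (rho : ℂ) ≠ 0 := by exact_mod_cast hrho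
  simp_rw [divStress_fourier]
  simp only [lameOp, hF, map_sum, map_smul, smul_eq_mul, Finset.mul_sum]
  rw [Finset.sum_comm_cycle]
  refine Finset.sum_congr rfl fun k _ => Finset.sum_congr rfl fun i _ =>
    Finset.sum_congr rfl fun j _ => Finset.sum_congr rfl fun l _ => ?_
  push_cast
  field_simp

/-- In `C_{ijkl} ξ_j ξ_l` the `lam` term and one `mu` term each give `ξ_i ξ_k`; the other `mu` term
gives `|ξ|² δ_{ik}`. -/
lemma lameOp_apply (rho lam mu : ℝ) (ψ : Fin 3 → 𝓢(Space, ℂ)) (k : Fin 3) (ξ : Space) :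
    lameOp rho lam mu ψ k ξ = ((4 * Real.pi ^ 2 / rho : ℝ) : ℂ) *
      ((lam + mu : ℝ) * (ξ k : ℂ) * (∑ i, (ξ i : ℂ) * ψ i ξ) + mu * (‖ξ‖ ^ 2 : ℝ) * ψ k ξ) := by
  simp only [lameOp, _root_.sum_apply, _root_.smul_apply, mulCoord_apply, smul_eq_mul,
    EuclideanSpace.real_norm_sq_eq]
  fin_cases k <;> simp [Fin.sum_univ_three, stiffness] <;> ring

end Lame

namespace Lame

/-! ### Operations on functions of class `H²` -/

lemma intervalIntegrable_of_memLp {X : Type*} [NormedAddCommGroup X] {T : ℝ} {g : ℝ → X}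
    (hg : MemLp g 2 (volume.restrict (Ioo 0 T))) {t : ℝ} (ht : t ∈ Icc 0 T) :
    IntervalIntegrable g volume 0 t := by
  rw [intervalIntegrable_iff_integrableOn_Ioo_of_le ht.1]
  exact IntegrableOn.mono_set (hg.integrable (by norm_num)) (Ioo_subset_Ioo_right ht.2)

lemma IsH2.intervalIntegrable_deriv {X : Type*} [NormedAddCommGroup X] [NormedSpace ℝ X] {T : ℝ}
    {u v w : ℝ → X} (h : IsH2 T u v w) {t : ℝ} (ht : t ∈ Icc 0 T) :
    IntervalIntegrable v volume 0 t :=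
  ContinuousOn.intervalIntegrable <| by
    rw [uIcc_of_le ht.1]
    exact (h.continuousOn_deriv (ht.1.trans ht.2)).mono (Icc_subset_Icc_right ht.2)

lemma IsH2.congr_deriv2 {X : Type*} [NormedAddCommGroup X] [NormedSpace ℝ X] {T : ℝ}
    {u v w w' : ℝ → X} (h : IsH2 T u v w) (hw : w' = w) : IsH2 T u v w' := hw ▸ h

lemma IsH2.sub {X : Type*} [NormedAddCommGroup X] [NormedSpace ℝ X] {T : ℝ}
    {u v w u' v' w' : ℝ → X} (h : IsH2 T u v w) (h' : IsH2 T u' v' w') :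
    IsH2 T (fun t => u t - u' t) (fun t => v t - v' t) (fun t => w t - w' t) := by
  refine ⟨h.memLp.sub h'.memLp, fun t ht => ?_, fun t ht => ?_⟩
  · rw [intervalIntegral.integral_sub (h.intervalIntegrable_deriv ht)
      (h'.intervalIntegrable_deriv ht), h.eq_integral t ht, h'.eq_integral t ht]
    abel
  · rw [intervalIntegral.integral_sub (intervalIntegrable_of_memLp h.memLp ht)
      (intervalIntegrable_of_memLp h'.memLp ht), h.deriv_eq_integral t ht,
      h'.deriv_eq_integral t ht]
    abel

lemma IsH2.const_mul {T : ℝ} {u v w : ℝ → ℂ} (h : IsH2 T u v w) (c : ℂ) :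
    IsH2 T (fun t => c * u t) (fun t => c * v t) (fun t => c * w t) := by
  refine ⟨h.memLp.const_mul c, fun t ht => ?_, fun t ht => ?_⟩
  · rw [intervalIntegral.integral_const_mul, h.eq_integral t ht]
    ring
  · rw [intervalIntegral.integral_const_mul, h.deriv_eq_integral t ht]
    ring

lemma IsH2.sum {X : Type*} [NormedAddCommGroup X] [NormedSpace ℝ X] {ι : Type*} [Fintype ι] {T : ℝ}
    {u v w : ι → ℝ → X} (h : ∀ i, IsH2 T (u i) (v i) (w i)) :
    IsH2 T (fun t => ∑ i, u i t) (fun t => ∑ i, v i t) (fun t => ∑ i, w i t) := by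
  refine ⟨memLp_finsetSum _ fun i _ => (h i).memLp, fun t ht => ?_, fun t ht => ?_⟩
  · rw [intervalIntegral.integral_finsetSum fun i _ => (h i).intervalIntegrable_deriv ht,
      ← Finset.sum_add_distrib]
    exact Finset.sum_congr rfl fun i _ => (h i).eq_integral t ht
  · rw [intervalIntegral.integral_finsetSum fun i _ =>
      intervalIntegrable_of_memLp (h i).memLp ht, ← Finset.sum_add_distrib]
    exact Finset.sum_congr rfl fun i _ => (h i).deriv_eq_integral t ht

/-- A vector valued function is in `H²` if its components are. -/
lemma IsH2.of_components {T : ℝ} {u v w : ℝ → Vec}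
    (h : ∀ k, IsH2 T (fun t => u t k) (fun t => v t k) (fun t => w t k)) : IsH2 T u v w := by
  have hint : ∀ {f : ℝ → Vec} {t : ℝ}, 0 ≤ t →
      (∀ k, IntervalIntegrable (fun s => f s k) volume 0 t) → ∀ k,
      (∫ s in (0 : ℝ)..t, f s) k = ∫ s in (0 : ℝ)..t, f s k := by
    intro f t ht hf k
    simp only [intervalIntegral.integral_of_le ht]
    exact eval_integral_piLp (fun k =>
      (intervalIntegrable_iff_integrableOn_Ioc_of_le ht).1 (hf k)) k
  refine ⟨MemLp.of_eval_piLp fun k => (h k).memLp, fun t ht => ?_, fun t ht => ?_⟩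
  · ext k
    rw [PiLp.add_apply, hint ht.1 fun k => (h k).intervalIntegrable_deriv ht]
    exact (h k).eq_integral t ht
  · ext k
    rw [PiLp.add_apply, hint ht.1 fun k => intervalIntegrable_of_memLp (h k).memLp ht]
    exact (h k).deriv_eq_integral t ht

lemma IsH2.eq_integral_integral {X : Type*} [NormedAddCommGroup X] [NormedSpace ℝ X] {T : ℝ}
    {u v w w' : ℝ → X} (h : IsH2 T u v w) (hu : u 0 = 0) (hv : v 0 = 0)
    (hw : w =ᵐ[volume.restrict (Ioo 0 T)] w') {t : ℝ} (ht : t ∈ Icc 0 T) :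
    u t = ∫ s in (0 : ℝ)..t, ∫ r in (0 : ℝ)..s, w' r := by
  rw [h.eq_integral t ht, hu, zero_add]
  refine intervalIntegral.integral_congr fun s hs => ?_
  rw [uIcc_of_le ht.1] at hs
  have hsT : s ∈ Icc 0 T := ⟨hs.1, hs.2.trans ht.2⟩
  rw [h.deriv_eq_integral s hsT, hv, zero_add, intervalIntegral.integral_of_le hs.1,
    intervalIntegral.integral_of_le hs.1, integral_Ioc_eq_integral_Ioo,
    integral_Ioc_eq_integral_Ioo]
  exact integral_congr_ae (ae_restrict_of_ae_restrict_of_subset (Ioo_subset_Ioo_right hsT.2) hw)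

/-! ### Convolution with kernels of class `C²` -/

lemma memLp_conv {T : ℝ} (hT : 0 ≤ T) {κ g : ℝ → ℂ} (hκ : Continuous κ)
    (hg : MemLp g 2 (volume.restrict (Ioo 0 T))) :
    MemLp (fun t => ∫ s in (0 : ℝ)..t, κ (t - s) * g s) 2 (volume.restrict (Ioo 0 T)) := by
  have hgi := intervalIntegrable_of_memLp hg (t := T) ⟨hT, le_rfl⟩
  obtain ⟨B, hB⟩ := (isCompact_Icc (a := 0) (b := T)).exists_bound_of_continuousOn hκ.continuousOn
  have hm := intervalIntegrable_conv hκ hT hgi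
  rw [intervalIntegrable_iff_integrableOn_Ioo_of_le hT] at hm
  refine MemLp.of_bound hm.1 (∫ s in (0 : ℝ)..T, |B| * ‖g s‖) ?_
  filter_upwards [ae_restrict_mem measurableSet_Ioo] with t ht
  have htT := Ioo_subset_Icc_self ht
  have h1 : ‖∫ s in (0 : ℝ)..t, κ (t - s) * g s‖ ≤ ∫ s in (0 : ℝ)..t, |B| * ‖g s‖ := by
    refine intervalIntegral.norm_integral_le_of_norm_le ht.1.le
      (Filter.Eventually.of_forall fun s hs => ?_)
      ((intervalIntegrable_of_memLp hg htT).norm.const_mul _)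
    rw [norm_mul]
    refine mul_le_mul_of_nonneg_right ((hB _ ?_).trans (le_abs_self B)) (norm_nonneg _)
    exact ⟨by linarith [hs.2], by linarith [hs.1, ht.2]⟩
  exact h1.trans (intervalIntegral.integral_mono_interval le_rfl ht.1.le ht.2.le
    (Filter.Eventually.of_forall fun s => by positivity) (hgi.norm.const_mul _))

/-- The boundary term of the first differentiation vanishes because `κ(0) = 0`; that of the second
is `κ'(0) g`, which brings `g` itself out of the convolution. -/
lemma isH2_conv {T : ℝ} (hT : 0 ≤ T) {κ κ' κ'' g : ℝ → ℂ} (h0 : κ 0 = 0)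
    (hκ : ∀ τ, HasDerivAt κ (κ' τ) τ) (hκ' : ∀ τ, HasDerivAt κ' (κ'' τ) τ) (hκ'' : Continuous κ'')
    (hg : MemLp g 2 (volume.restrict (Ioo 0 T))) :
    IsH2 T (fun t => ∫ s in (0 : ℝ)..t, κ (t - s) * g s)
      (fun t => ∫ s in (0 : ℝ)..t, κ' (t - s) * g s)
      (fun t => κ' 0 * g t + ∫ s in (0 : ℝ)..t, κ'' (t - s) * g s) := by
  have hc : Continuous κ' := continuous_iff_continuousAt.2 fun τ => (hκ' τ).continuousAt
  refine ⟨(hg.const_mul _).add (memLp_conv hT hκ'' hg), fun t ht => ?_, fun t ht => ?_⟩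
  · simpa [h0] using conv_eq_integral hκ hc ht.1 (intervalIntegrable_of_memLp hg ht)
  · simpa using conv_eq_integral hκ' hκ'' ht.1 (intervalIntegrable_of_memLp hg ht)

/-- The convolution of a vector valued function with a matrix kernel. -/
noncomputable def matrixConv (κ : Fin 3 → Fin 3 → ℝ → ℂ) (g : ℝ → Vec) (t : ℝ) : Vec :=
  WithLp.toLp 2 fun k => ∑ i, ∫ s in (0 : ℝ)..t, κ i k (t - s) * g s i

lemma matrixConv_apply (κ : Fin 3 → Fin 3 → ℝ → ℂ) (g : ℝ → Vec) (t : ℝ) (k : Fin 3) :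
    matrixConv κ g t k = ∑ i, ∫ s in (0 : ℝ)..t, κ i k (t - s) * g s i := rfl

lemma matrixConv_sub {T : ℝ} {κ : Fin 3 → Fin 3 → ℝ → ℂ} (hκ : ∀ i k, Continuous (κ i k))
    {g₁ g₂ : ℝ → Vec} (h₁ : MemLp g₁ 2 (volume.restrict (Ioo 0 T)))
    (h₂ : MemLp g₂ 2 (volume.restrict (Ioo 0 T))) {t : ℝ} (ht : t ∈ Icc 0 T) :
    matrixConv κ (g₁ - g₂) t = matrixConv κ g₁ t - matrixConv κ g₂ t := by
  ext k
  have hint : ∀ {g : ℝ → Vec}, MemLp g 2 (volume.restrict (Ioo 0 T)) → ∀ i,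
      IntervalIntegrable (fun s => κ i k (t - s) * g s i) volume 0 t := fun hg i =>
    (intervalIntegrable_of_memLp (hg.eval_piLp i) ht).continuousOn_mul
      ((hκ i k).comp (by fun_prop)).continuousOn
  rw [PiLp.sub_apply, matrixConv_apply, matrixConv_apply, matrixConv_apply,
    ← Finset.sum_sub_distrib]
  refine Finset.sum_congr rfl fun i _ => ?_
  rw [← intervalIntegral.integral_sub (hint h₁ i) (hint h₂ i)]
  refine intervalIntegral.integral_congr fun s _ => ?_
  simp only [Pi.sub_apply, PiLp.sub_apply]
  ring

lemma norm_vec_le_sum (z : Vec) : ‖z‖ ≤ ∑ k, ‖z k‖ := by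
  have h : z = ∑ k, EuclideanSpace.single k (z k) := by
    ext k; simp
  conv_lhs => rw [h]
  exact (norm_sum_le _ _).trans_eq (by simp)

/-- For a matrix kernel `κ` of class `C²` with `κ(0) = 0` and `κ'(0) = z I`, where `|z| ≥ δ`, the
convolution `κ * g` is of class `H²`, and its second derivative controls `g` in `L²`. -/
lemma isH2_matrixConv {T δ B : ℝ} (hT : 0 < T) (hδ : 0 < δ) (hB0 : 0 ≤ B) {z : ℂ} (hz : δ ≤ ‖z‖)
    {κ κ' κ'' : Fin 3 → Fin 3 → ℝ → ℂ} (h0 : ∀ i k, κ i k 0 = 0)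
    (h0' : ∀ i k, κ' i k 0 = if i = k then z else 0)
    (hκ : ∀ i k τ, HasDerivAt (κ i k) (κ' i k τ) τ)
    (hκ' : ∀ i k τ, HasDerivAt (κ' i k) (κ'' i k τ) τ) (hκ'' : ∀ i k, Continuous (κ'' i k))
    (hB : ∀ i k τ, ‖κ'' i k τ‖ ≤ B) {g : ℝ → Vec} (hg : MemLp g 2 (volume.restrict (Ioo 0 T))) :
    ∃ v w : ℝ → Vec, IsH2 T (matrixConv κ g) v w ∧ eLpNorm g 2 (volume.restrict (Ioo 0 T)) ≤
      ENNReal.ofReal (volterraConst (1 / δ) (9 * B / δ + 1) T) *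
        eLpNorm w 2 (volume.restrict (Ioo 0 T)) := by
  set w : ℝ → Vec := fun t => z • g t + matrixConv κ'' g t with hw
  have hH : IsH2 T (matrixConv κ g) (matrixConv κ' g) w := by
    refine IsH2.of_components fun k => ?_
    have h := IsH2.sum fun i => isH2_conv hT.le (h0 i k) (hκ i k) (hκ' i k) (hκ'' i k)
      (hg.eval_piLp i)
    have hwk : (fun t => w t k) = fun t =>
        ∑ i, (κ' i k 0 * g t i + ∫ s in (0 : ℝ)..t, κ'' i k (t - s) * g s i) := by
      ext t
      simp [hw, matrixConv_apply, h0', Finset.sum_add_distrib]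
    rw [hwk]
    exact h
  -- The factor 9 counts the matrix entries; the summand 1 keeps the Volterra coefficient positive
  -- when `B = 0`.
  refine ⟨_, w, hH, eLpNorm_le_of_volterra hT (by positivity) hg hH.memLp ?_⟩
  filter_upwards [ae_restrict_mem measurableSet_Ioo] with t ht
  have htT := Ioo_subset_Icc_self ht
  have hgi := intervalIntegrable_of_memLp hg htT
  set J := ∫ s in (0 : ℝ)..t, ‖g s‖
  have hJ : 0 ≤ J := intervalIntegral.integral_nonneg ht.1.le fun s _ => norm_nonneg _
  have h1 : ∀ i k, ‖∫ s in (0 : ℝ)..t, κ'' i k (t - s) * g s i‖ ≤ B * J := by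
    intro i k
    rw [← intervalIntegral.integral_const_mul]
    refine intervalIntegral.norm_integral_le_of_norm_le ht.1.le
      (Filter.Eventually.of_forall fun s _ => ?_) (hgi.norm.const_mul _)
    rw [norm_mul]
    exact mul_le_mul (hB i k _) (PiLp.norm_apply_le _ i) (norm_nonneg _) hB0
  have h2 : ‖matrixConv κ'' g t‖ ≤ 9 * B * J := by
    refine (norm_vec_le_sum _).trans ?_
    calc ∑ k, ‖matrixConv κ'' g t k‖ ≤ ∑ _k : Fin 3, ∑ _i : Fin 3, B * J :=
          Finset.sum_le_sum fun k _ => (norm_sum_le _ _).trans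
            (Finset.sum_le_sum fun i _ => h1 i k)
      _ = 9 * B * J := by simp; ring
  have h3 : ‖z • g t‖ ≤ ‖w t‖ + 9 * B * J := by
    have : z • g t = w t - matrixConv κ'' g t := by simp [hw]
    rw [this]
    exact (norm_sub_le _ _).trans (by linarith)
  rw [norm_smul] at h3
  have h4 : δ * ‖g t‖ ≤ ‖w t‖ + 9 * B * J :=
    (mul_le_mul_of_nonneg_right hz (norm_nonneg _)).trans h3
  calc ‖g t‖ = (δ * ‖g t‖) / δ := by field_simp
    _ ≤ (‖w t‖ + 9 * B * J) / δ := by gcongr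
    _ = 1 / δ * ‖w t‖ + 9 * B / δ * J := by ring
    _ ≤ _ := by
      have : 9 * B / δ * J ≤ (9 * B / δ + 1) * J := mul_le_mul_of_nonneg_right (by linarith) hJ
      linarith

end Lame

namespace Lame

open FourierTransform

/-! ### Duhamel's formula tested against Schwartz functions -/

/-- The speed of longitudinal waves, times `2π`. -/
noncomputable def speedL (rho lam mu : ℝ) : ℝ := 2 * Real.pi * Real.sqrt ((lam + 2 * mu) / rho)

/-- The speed of transverse waves, times `2π`. -/
noncomputable def speedT (rho mu : ℝ) : ℝ := 2 * Real.pi * Real.sqrt (mu / rho)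

section Symbol

variable {rho lam mu : ℝ}

lemma speedL_pos (hrho : 0 < rho) (hL : 0 < lam + 2 * mu) : 0 < speedL rho lam mu := by
  unfold speedL; positivity

lemma speedT_pos (hrho : 0 < rho) (hmu : 0 < mu) : 0 < speedT rho mu := by
  unfold speedT; positivity

lemma speedL_sq (hrho : 0 < rho) (hL : 0 < lam + 2 * mu) :
    speedL rho lam mu ^ 2 = 4 * Real.pi ^ 2 / rho * (lam + 2 * mu) := by
  rw [speedL, mul_pow, Real.sq_sqrt (by positivity)]; ring

lemma speedT_sq (hrho : 0 < rho) (hmu : 0 < mu) :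
    speedT rho mu ^ 2 = 4 * Real.pi ^ 2 / rho * mu := by
  rw [speedT, mul_pow, Real.sq_sqrt (by positivity)]; ring

lemma ofReal_sum_sq (ξ : Space) : ∑ j, (ξ j : ℂ) ^ 2 = (‖ξ‖ ^ 2 : ℝ) := by
  rw [EuclideanSpace.real_norm_sq_eq]; push_cast; rfl

lemma sum_proj_mul (i : Fin 3) (ξ : Space) (X : Fin 3 → ℂ) :
    ∑ j, (proj i j ξ : ℂ) * X j = (ξ i : ℂ) / (‖ξ‖ ^ 2 : ℝ) * ∑ j, (ξ j : ℂ) * X j := by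
  rw [Finset.mul_sum]
  refine Finset.sum_congr rfl fun j _ => ?_
  simp only [proj]
  push_cast
  ring

lemma sum_coproj_mul (i : Fin 3) (ξ : Space) (X : Fin 3 → ℂ) :
    ∑ j, (coproj i j ξ : ℂ) * X j = X i - ∑ j, (proj i j ξ : ℂ) * X j := by
  have h : ∀ j, (((if i = j then 1 else 0 : ℝ)) : ℂ) * X j = if i = j then X j else 0 := by
    intro j; split_ifs <;> simp
  simp [coproj, sub_mul, Finset.sum_sub_distrib, h]

lemma norm_sq_mul_sum_proj_mul (i : Fin 3) (ξ : Space) (X : Fin 3 → ℂ) :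
    ((‖ξ‖ ^ 2 : ℝ) : ℂ) * ∑ j, (proj i j ξ : ℂ) * X j = (ξ i : ℂ) * ∑ j, (ξ j : ℂ) * X j := by
  rw [sum_proj_mul]
  rcases eq_or_ne ξ 0 with rfl | hξ
  · simp
  · have : ((‖ξ‖ ^ 2 : ℝ) : ℂ) ≠ 0 := by
      have := norm_ne_zero_iff.2 hξ
      exact_mod_cast pow_ne_zero 2 this
    field_simp

/-- Longitudinal fields are eigenvectors of the Lamé operator. -/
lemma sum_proj_mul_lameOp (hrho : 0 < rho) (hL : 0 < lam + 2 * mu) (ψ : Fin 3 → 𝓢(Space, ℂ))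
    (i : Fin 3) (ξ : Space) : ∑ j, (proj i j ξ : ℂ) * lameOp rho lam mu ψ j ξ =
      ((speedL rho lam mu ^ 2 * ‖ξ‖ ^ 2 : ℝ) : ℂ) * ∑ j, (proj i j ξ : ℂ) * ψ j ξ := by
  rw [sum_proj_mul, sum_proj_mul, speedL_sq hrho hL]
  have h := ofReal_sum_sq ξ
  simp only [lameOp_apply, Fin.sum_univ_three] at h ⊢
  push_cast at h ⊢
  linear_combination ((ξ i : ℂ) / (‖ξ‖ ^ 2 : ℂ) * (4 * Real.pi ^ 2 / rho) * (lam + mu) *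
    (ξ 0 * ψ 0 ξ + ξ 1 * ψ 1 ξ + ξ 2 * ψ 2 ξ)) * h

/-- Transverse fields are eigenvectors of the Lamé operator. -/
lemma sum_coproj_mul_lameOp (hrho : 0 < rho) (hmu : 0 < mu) (hL : 0 < lam + 2 * mu)
    (ψ : Fin 3 → 𝓢(Space, ℂ)) (i : Fin 3) (ξ : Space) :
    ∑ j, (coproj i j ξ : ℂ) * lameOp rho lam mu ψ j ξ =
      ((speedT rho mu ^ 2 * ‖ξ‖ ^ 2 : ℝ) : ℂ) * ∑ j, (coproj i j ξ : ℂ) * ψ j ξ := by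
  have h := norm_sq_mul_sum_proj_mul i ξ fun j => ψ j ξ
  rw [sum_coproj_mul, sum_coproj_mul, sum_proj_mul_lameOp hrho hL, speedL_sq hrho hL,
    speedT_sq hrho hmu, lameOp_apply]
  push_cast at h ⊢
  linear_combination (-(4 * (Real.pi : ℂ) ^ 2 / rho) * (lam + mu)) * h

/-- Both sides vanish at `y = 0`, so the wave equation for `kern` needs no exception at zero
frequency. -/
lemma neg_sin_mul_eq (y τ : ℝ) : -Real.sin (y * τ) * y = -(y ^ 2) * (Real.sin (y * τ) / y) := by
  rcases eq_or_ne y 0 with rfl | hy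
  · simp
  · field_simp

/-- The fundamental solution solves the Lamé system in Fourier variables. -/
lemma sum_kernDeriv2_mul (hrho : 0 < rho) (hmu : 0 < mu) (hL : 0 < lam + 2 * mu)
    (ψ : Fin 3 → 𝓢(Space, ℂ)) (i : Fin 3) (τ : ℝ) (ξ : Space) :
    ∑ j, (kernDeriv2 (speedL rho lam mu) (speedT rho mu) i j τ ξ : ℂ) * ψ j ξ =
      -∑ j, (kern (speedL rho lam mu) (speedT rho mu) i j τ ξ : ℂ) * lameOp rho lam mu ψ j ξ := by
  have h1 := sum_proj_mul_lameOp hrho hL ψ i ξ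
  have h2 := sum_coproj_mul_lameOp hrho hmu hL ψ i ξ
  simp only [kernDeriv2, kern, neg_sin_mul_eq, Fin.sum_univ_three] at h1 h2 ⊢
  generalize Real.sin (speedL rho lam mu * ‖ξ‖ * τ) / (speedL rho lam mu * ‖ξ‖) = x
  generalize Real.sin (speedT rho mu * ‖ξ‖ * τ) / (speedT rho mu * ‖ξ‖) = y
  push_cast at h1 h2 ⊢
  linear_combination (x : ℂ) * h1 + (y : ℂ) * h2

end Symbol

section Duhamel

variable {rho lam mu T : ℝ} {F : Space → ℂ} {g : ℝ → Vec}

lemma integrable_schwartz_mul (hF : Integrable F) (ψ : 𝓢(Space, ℂ)) :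
    Integrable fun ξ => ψ ξ * F ξ :=
  hF.bdd_mul (c := ‖ψ.toBoundedContinuousFunction‖) ψ.continuous.aestronglyMeasurable
    (Filter.Eventually.of_forall fun ξ => ψ.toBoundedContinuousFunction.norm_coe_le_norm ξ)

lemma integrable_norm_mul_schwartz_mul (hF1 : Integrable fun ξ => ‖ξ‖ * ‖F ξ‖) (ψ : 𝓢(Space, ℂ)) :
    Integrable fun ξ => ‖ξ‖ * ‖ψ ξ * F ξ‖ := by
  have h : Integrable fun ξ => ‖ψ ξ‖ * (‖ξ‖ * ‖F ξ‖) :=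
    hF1.bdd_mul (c := ‖ψ.toBoundedContinuousFunction‖) ψ.continuous.norm.aestronglyMeasurable
      (Filter.Eventually.of_forall fun ξ => by
        rw [norm_norm]; exact ψ.toBoundedContinuousFunction.norm_coe_le_norm ξ)
  refine h.congr (Filter.Eventually.of_forall fun ξ => ?_)
  simp only [norm_mul]
  ring

/-- The fundamental solution paired with the test function `ψ` and the spatial source with Fourier
transform `F`. -/
noncomputable def testKernel (rho lam mu : ℝ) (F : Space → ℂ) (ψ : Fin 3 → 𝓢(Space, ℂ)) (i : Fin 3)
    (τ : ℝ) : ℂ :=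
  ∑ j, symbolIntegral (kern (speedL rho lam mu) (speedT rho mu) i j) (fun ξ => ψ j ξ * F ξ) τ

/-- Duhamel's formula, tested against `ψ`. -/
noncomputable def duhamel (rho lam mu : ℝ) (F : Space → ℂ) (g : ℝ → Vec) (ψ : Fin 3 → 𝓢(Space, ℂ))
    (t : ℝ) : ℂ :=
  1 / rho * ∑ i, ∫ s in (0 : ℝ)..t, testKernel rho lam mu F ψ i (t - s) * g s i

lemma integrable_kernDeriv2_mul {a b : ℝ} (ha : 0 ≤ a) (hb : 0 ≤ b) {i j : Fin 3} {ω : Space → ℂ}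
    (hω : AEStronglyMeasurable ω volume) (hω1 : Integrable fun ξ => ‖ξ‖ * ‖ω ξ‖) (τ : ℝ) :
    Integrable fun ξ => (kernDeriv2 a b i j τ ξ : ℂ) * ω ξ := by
  refine (hω1.const_mul (a + 2 * b)).mono'
    (aestronglyMeasurable_symbol_mul (measurable_kernDeriv2 τ) hω)
    (Filter.Eventually.of_forall fun ξ => ?_)
  rw [← mul_assoc]
  exact norm_symbol_mul_le (abs_kernDeriv2_le ha hb τ ξ)

/-- The symbol identity `sum_kernDeriv2_mul` in integrated form: two time derivatives of the kernel
amount to `-lameOp` acting on the test function. -/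
lemma sum_kernDeriv2Integral (hrho : 0 < rho) (hmu : 0 < mu) (hL : 0 < lam + 2 * mu)
    (hF : Integrable F) (hF1 : Integrable fun ξ => ‖ξ‖ * ‖F ξ‖) (ψ : Fin 3 → 𝓢(Space, ℂ))
    (i : Fin 3) (τ : ℝ) :
    ∑ j, symbolIntegral (kernDeriv2 (speedL rho lam mu) (speedT rho mu) i j)
      (fun ξ => ψ j ξ * F ξ) τ = -testKernel rho lam mu F (lameOp rho lam mu ψ) i τ := by
  simp only [testKernel, symbolIntegral]
  rw [← integral_finsetSum _ fun j _ => integrable_kernDeriv2_mul (speedL_pos hrho hL).le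
      (speedT_pos hrho hmu).le (integrable_schwartz_mul hF (ψ j)).1
      (integrable_norm_mul_schwartz_mul hF1 (ψ j)) τ,
    ← integral_finsetSum _ fun j _ => integrable_kern_mul (integrable_schwartz_mul hF _) τ,
    ← integral_neg]
  refine integral_congr_ae (Filter.Eventually.of_forall fun ξ => ?_)
  simp only [← mul_assoc, ← Finset.sum_mul]
  rw [sum_kernDeriv2_mul hrho hmu hL, neg_mul]

/-- Duhamel's formula obeys the same relation between `ψ` and `lameOp ψ` as a weak solution, with
the same source term, which therefore cancels in the difference. -/
lemma isH2_duhamel (hT : 0 ≤ T) (hrho : 0 < rho) (hmu : 0 < mu) (hL : 0 < lam + 2 * mu)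
    (hF : Integrable F) (hF1 : Integrable fun ξ => ‖ξ‖ * ‖F ξ‖)
    (hg : MemLp g 2 (volume.restrict (Ioo 0 T))) (ψ : Fin 3 → 𝓢(Space, ℂ)) :
    ∃ v : ℝ → ℂ, v 0 = 0 ∧ IsH2 T (duhamel rho lam mu F g ψ) v fun t =>
      1 / rho * ∑ i, (∫ ξ, ψ i ξ * F ξ) * g t i - duhamel rho lam mu F g (lameOp rho lam mu ψ) t := by
  set a := speedL rho lam mu with ha
  set b := speedT rho mu with hb
  have ha0 : 0 < a := speedL_pos hrho hL
  have hb0 : 0 < b := speedT_pos hrho hmu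
  have h := fun i => isH2_conv hT (κ := testKernel rho lam mu F ψ i)
    (κ' := fun τ => ∑ j, symbolIntegral (kernDeriv a b i j) (fun ξ => ψ j ξ * F ξ) τ)
    (κ'' := fun τ => -testKernel rho lam mu F (lameOp rho lam mu ψ) i τ)
    (by simp [testKernel])
    (fun τ => by
      exact HasDerivAt.fun_sum fun j _ =>
        hasDerivAt_kernIntegral ha0.ne' hb0.ne' (integrable_schwartz_mul hF (ψ j)) τ)
    (fun τ => by
      rw [← sum_kernDeriv2Integral hrho hmu hL hF hF1]
      exact HasDerivAt.fun_sum fun j _ => hasDerivAt_kernDerivIntegral ha0.le hb0.le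
        (integrable_schwartz_mul hF (ψ j)) (integrable_norm_mul_schwartz_mul hF1 (ψ j)) τ)
    (by
      simp_rw [← sum_kernDeriv2Integral hrho hmu hL hF hF1]
      exact continuous_finsetSum _ fun j _ => continuous_kernDeriv2Integral ha0.le hb0.le
        (integrable_schwartz_mul hF (ψ j)).1 (integrable_norm_mul_schwartz_mul hF1 (ψ j)))
    (hg.eval_piLp i)
  have h' := (IsH2.sum h).const_mul (1 / (rho : ℂ))
  refine ⟨_, ?_, h'.congr_deriv2 ?_⟩
  · simp
  · funext t
    simp only [duhamel, kernDerivIntegral_zero, Finset.sum_ite_eq, Finset.mem_univ, if_true,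
      neg_mul, intervalIntegral.integral_neg, Finset.sum_add_distrib, Finset.sum_neg_distrib]
    ring

@[simp] lemma duhamel_zero (ψ : Fin 3 → 𝓢(Space, ℂ)) : duhamel rho lam mu F g ψ 0 = 0 := by
  simp [duhamel]

/-- The components of `ψ` are bounded by `N` and supported in the ball of radius `r`. -/
def IsTest (r : ℝ) (ψ : Fin 3 → 𝓢(Space, ℂ)) (N : ℝ) : Prop :=
  ∀ i ξ, ‖ψ i ξ‖ ≤ N ∧ (r < ‖ξ‖ → ψ i ξ = 0)

lemma IsTest.nonneg {r N : ℝ} {ψ : Fin 3 → 𝓢(Space, ℂ)} (h : IsTest r ψ N) : 0 ≤ N :=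
  (norm_nonneg _).trans (h 0 0).1

/-- Multiplication by a polynomial in `ξ` keeps supports, and on `|ξ| ≤ r` the quadratic symbol is
bounded. The factor in front of `N` is the growth rate `L` of the power iteration. -/
lemma IsTest.lameOp {r N : ℝ} (hrho : 0 < rho) (hmu : 0 < mu) (hr : 0 ≤ r)
    {ψ : Fin 3 → 𝓢(Space, ℂ)} (h : IsTest r ψ N) : IsTest r (lameOp rho lam mu ψ)
      (4 * Real.pi ^ 2 / rho * (3 * |lam + mu| + mu) * r ^ 2 * N) := by
  have hN := h.nonneg
  intro k ξ
  rw [lameOp_apply]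
  rcases lt_or_ge r ‖ξ‖ with hξ | hξ
  · have h0 : ∀ i, ψ i ξ = 0 := fun i => (h i ξ).2 hξ
    simp only [h0, mul_zero, Finset.sum_const_zero, add_zero, norm_zero, implies_true, and_true]
    positivity
  · refine ⟨?_, fun h' => absurd h' (not_lt.2 hξ)⟩
    have hc : ∀ i, ‖(ξ i : ℂ)‖ ≤ r := fun i => by
      rw [Complex.norm_real]; exact (PiLp.norm_apply_le ξ i).trans hξ
    have h1 : ‖∑ i, (ξ i : ℂ) * ψ i ξ‖ ≤ 3 * (r * N) := by
      refine (norm_sum_le _ _).trans ?_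
      calc ∑ i, ‖(ξ i : ℂ) * ψ i ξ‖ ≤ ∑ _i : Fin 3, r * N := Finset.sum_le_sum fun i _ => by
            rw [norm_mul]
            exact mul_le_mul (hc i) (h i ξ).1 (norm_nonneg _) hr
        _ = _ := by simp
    have h2 : ‖((lam + mu : ℝ) : ℂ) * (ξ k : ℂ) * ∑ i, (ξ i : ℂ) * ψ i ξ‖ ≤
        |lam + mu| * r * (3 * (r * N)) := by
      rw [norm_mul, norm_mul, Complex.norm_real, Real.norm_eq_abs]
      exact mul_le_mul (mul_le_mul_of_nonneg_left (hc k) (abs_nonneg _)) h1 (norm_nonneg _)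
        (by positivity)
    have h3 : ‖(mu : ℂ) * ((‖ξ‖ ^ 2 : ℝ) : ℂ) * ψ k ξ‖ ≤ mu * r ^ 2 * N := by
      rw [norm_mul, norm_mul, Complex.norm_real, Complex.norm_real, Real.norm_of_nonneg hmu.le,
        Real.norm_of_nonneg (by positivity)]
      have := (h k ξ).1
      gcongr
    rw [norm_mul, Complex.norm_real, Real.norm_of_nonneg (by positivity)]
    calc _ ≤ 4 * Real.pi ^ 2 / rho * (|lam + mu| * r * (3 * (r * N)) + mu * r ^ 2 * N) :=
          mul_le_mul_of_nonneg_left ((norm_add_le _ _).trans (add_le_add h2 h3)) (by positivity)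
      _ = _ := by ring

lemma norm_testKernel_le {r N : ℝ} (hF : Integrable F) {ψ : Fin 3 → 𝓢(Space, ℂ)}
    (h : IsTest r ψ N) (i : Fin 3) {τ : ℝ} (hτ : |τ| ≤ T) :
    ‖testKernel rho lam mu F ψ i τ‖ ≤ 9 * T * (∫ ξ, ‖F ξ‖) * N := by
  have hT := (abs_nonneg τ).trans hτ
  have h1 : ∀ j, ‖symbolIntegral (kern (speedL rho lam mu) (speedT rho mu) i j)
      (fun ξ => ψ j ξ * F ξ) τ‖ ≤ 3 * T * (N * ∫ ξ, ‖F ξ‖) := by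
    intro j
    refine (norm_kernIntegral_le (integrable_schwartz_mul hF (ψ j)) τ).trans ?_
    have h2 : ∫ ξ, ‖ψ j ξ * F ξ‖ ≤ N * ∫ ξ, ‖F ξ‖ := by
      rw [← integral_const_mul]
      refine integral_mono (integrable_schwartz_mul hF (ψ j)).norm (hF.norm.const_mul _) fun ξ => ?_
      simp only [norm_mul]
      exact mul_le_mul_of_nonneg_right (h j ξ).1 (norm_nonneg _)
    exact mul_le_mul (by linarith) h2 (integral_nonneg fun ξ => norm_nonneg _) (by positivity)
  refine (norm_sum_le _ _).trans ((Finset.sum_le_sum fun j _ => h1 j).trans_eq ?_)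
  simp
  ring

/-- A crude bound suffices; what matters is that it is linear in `N` with a constant independent of
`ψ`. -/
lemma norm_duhamel_le {r N : ℝ} (hT : 0 ≤ T) (hF : Integrable F)
    (hg : MemLp g 2 (volume.restrict (Ioo 0 T))) {ψ : Fin 3 → 𝓢(Space, ℂ)} (h : IsTest r ψ N)
    {t : ℝ} (ht : t ∈ Icc 0 T) :
    ‖duhamel rho lam mu F g ψ t‖ ≤
      |1 / rho| * (27 * T * (∫ ξ, ‖F ξ‖) * ∫ s in (0 : ℝ)..T, ‖g s‖) * N := by
  have hN := h.nonneg
  have hI : 0 ≤ ∫ ξ, ‖F ξ‖ := integral_nonneg fun ξ => norm_nonneg _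
  have hgT := intervalIntegrable_of_memLp hg (t := T) ⟨hT, le_rfl⟩
  have hgt := intervalIntegrable_of_memLp hg ht
  have h1 : ∀ i, ‖∫ s in (0 : ℝ)..t, testKernel rho lam mu F ψ i (t - s) * g s i‖ ≤
      9 * T * (∫ ξ, ‖F ξ‖) * N * ∫ s in (0 : ℝ)..T, ‖g s‖ := by
    intro i
    have h2 : ∫ s in (0 : ℝ)..t, ‖g s‖ ≤ ∫ s in (0 : ℝ)..T, ‖g s‖ :=
      intervalIntegral.integral_mono_interval le_rfl ht.1 ht.2
        (Filter.Eventually.of_forall fun s => norm_nonneg _) hgT.norm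
    refine le_trans ?_ (mul_le_mul_of_nonneg_left h2 (by positivity))
    rw [← intervalIntegral.integral_const_mul]
    refine intervalIntegral.norm_integral_le_of_norm_le ht.1
      (Filter.Eventually.of_forall fun s hs => ?_) (hgt.norm.const_mul _)
    rw [norm_mul]
    refine mul_le_mul (norm_testKernel_le hF h i ?_) (PiLp.norm_apply_le _ i) (norm_nonneg _)
      (by positivity)
    rw [abs_of_nonneg (by linarith [hs.2])]
    linarith [hs.1, ht.2]
  rw [duhamel, norm_mul]
  have h3 : ‖(1 / (rho : ℂ))‖ = |1 / rho| := by
    rw [← Complex.ofReal_one, ← Complex.ofReal_div, Complex.norm_real, Real.norm_eq_abs]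
  rw [h3, mul_assoc]
  refine mul_le_mul_of_nonneg_left ?_ (abs_nonneg _)
  refine (norm_sum_le _ _).trans ((Finset.sum_le_sum fun i _ => h1 i).trans_eq ?_)
  simp
  ring

/-- The pairing of a square integrable function with a bounded function supported in a ball. -/
lemma norm_integral_mul_le_of_isTest {r N : ℝ} {ψ : Fin 3 → 𝓢(Space, ℂ)} (h : IsTest r ψ N)
    (V : L2) (i : Fin 3) :
    ‖∫ ξ, ψ i ξ * V ξ‖ ≤ (volume.real (Metric.closedBall (0 : Space) r) + ‖V‖ ^ 2) * N := by
  have hN := h.nonneg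
  have hVi : Integrable fun ξ => ‖V ξ‖ ^ 2 := (Lp.memLp V).integrable_norm_pow (by norm_num)
  have hball : Integrable ((Metric.closedBall (0 : Space) r).indicator fun _ => (1 : ℝ)) :=
    (integrable_indicator_iff measurableSet_closedBall).2
      (integrableOn_const measure_closedBall_lt_top.ne)
  have hnorm : ‖V‖ ^ 2 = ∫ ξ, ‖V ξ‖ ^ 2 := by
    rw [norm_eq_sqrt_integral, ← Real.rpow_natCast, ← Real.rpow_mul
      (integral_nonneg fun ξ => by positivity)]
    norm_num
  have hsum : (volume.real (Metric.closedBall (0 : Space) r) + ‖V‖ ^ 2) * N =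
      ∫ ξ, ((Metric.closedBall (0 : Space) r).indicator (fun _ => (1 : ℝ)) ξ + ‖V ξ‖ ^ 2) * N := by
    rw [integral_mul_const, integral_add hball hVi, hnorm,
      integral_indicator measurableSet_closedBall]
    simp
  rw [hsum]
  -- On the ball `‖V‖ ≤ 1 + ‖V‖²` replaces Cauchy–Schwarz; outside it `ψ` vanishes.
  refine norm_integral_le_of_norm_le ((hball.add hVi).mul_const _)
    (Filter.Eventually.of_forall fun ξ => ?_)
  rw [norm_mul]
  rcases lt_or_ge r ‖ξ‖ with hξ | hξ
  · rw [(h i ξ).2 hξ, norm_zero, zero_mul]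
    exact mul_nonneg (add_nonneg (indicator_nonneg (fun _ _ => zero_le_one) _) (sq_nonneg _)) hN
  · rw [indicator_of_mem (by simpa using hξ), mul_comm]
    refine mul_le_mul ?_ (h i ξ).1 (norm_nonneg _) (by positivity)
    nlinarith [sq_nonneg (‖V ξ‖ - 1), norm_nonneg (V ξ)]

end Duhamel

end Lame

namespace Lame

open FourierTransform

/-! ### Representation of solutions -/

section Representation

variable {rho lam mu T : ℝ} {f : Space → ℂ} {g : ℝ → Vec}

/-- Uniqueness: Duhamel's formula holds for every weak solution, tested against functions with
compactly supported Fourier transform. -/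
lemma sum_pairing_eq_duhamel (hT : 0 ≤ T) (hrho : 0 < rho) (hmu : 0 < mu) (hL : 0 < lam + 2 * mu)
    (hf : Integrable f) (hF : Integrable (𝓕 f)) (hF1 : Integrable fun ξ => ‖ξ‖ * ‖𝓕 f ξ‖)
    (hg : MemLp g 2 (volume.restrict (Ioo 0 T))) {V : ℝ → Fin 3 → L2}
    (hV : ∀ i, ContinuousOn (fun t => V t i) (Icc 0 T))
    (hweak : ∀ (i : Fin 3) (φ : 𝓢(Space, ℂ)), ∃ v w : ℝ → ℂ,
      IsH2 T (fun t => (V t i : 𝓢'(Space, ℂ)) φ) v w ∧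
      (V 0 i : 𝓢'(Space, ℂ)) φ = 0 ∧ v 0 = 0 ∧
      ∀ᵐ t ∂volume.restrict (Ioo 0 T), (rho : ℂ) * w t =
        divStress lam mu (fun k => (V t k : 𝓢'(Space, ℂ))) i φ + g t i * ∫ x, φ x * f x)
    {r N : ℝ} (hr : 0 ≤ r) {ψ : Fin 3 → 𝓢(Space, ℂ)} (hψ : IsTest r ψ N) {t : ℝ}
    (ht : t ∈ Icc 0 T) :
    ∑ i, (V t i : 𝓢'(Space, ℂ)) (𝓕 (ψ i)) = duhamel rho lam mu (𝓕 f) g ψ t := by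
  have hrho' : (rho : ℂ) ≠ 0 := by exact_mod_cast hrho.ne'
  choose B hB using fun i => isCompact_Icc.exists_bound_of_continuousOn (hV i)
  set d : (Fin 3 → 𝓢(Space, ℂ)) → ℝ → ℂ := fun ψ t =>
    ∑ i, (V t i : 𝓢'(Space, ℂ)) (𝓕 (ψ i)) - duhamel rho lam mu (𝓕 f) g ψ t with hd
  refine sub_eq_zero.1 (eq_zero_of_eq_neg_integral_integral (d := d) (A := lameOp rho lam mu)
    (S := IsTest r) (L := 4 * Real.pi ^ 2 / rho * (3 * |lam + mu| + mu) * r ^ 2)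
    (c := ∑ i, (volume.real (Metric.closedBall (0 : Space) r) + B i ^ 2) +
      |1 / rho| * (27 * T * (∫ ξ, ‖𝓕 f ξ‖) * ∫ s in (0 : ℝ)..T, ‖g s‖))
    (by positivity) (fun ψ N h => h.lameOp hrho hmu hr) (fun ψ N h => h.nonneg)
    (fun ψ N h t ht => ?_) (fun ψ N h t ht => ?_) hψ ht)
  · rw [add_mul, Finset.sum_mul]
    refine (norm_sub_le _ _).trans (add_le_add ((norm_sum_le _ _).trans
      (Finset.sum_le_sum fun i _ => ?_)) (norm_duhamel_le hT hF hg h ht))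
    rw [toTemperedDistribution_fourier_apply]
    refine (norm_integral_mul_le_of_isTest h _ i).trans
      (mul_le_mul_of_nonneg_right ?_ h.nonneg)
    rw [Lp.norm_fourier_eq]
    have := hB i t ht
    gcongr
  · choose v w hH h0 hv0 hw using fun i => hweak i (𝓕 (ψ i))
    obtain ⟨v', hv', hH'⟩ := isH2_duhamel hT hrho hmu hL hF hF1 hg ψ
    refine ((IsH2.sum hH).sub hH').eq_integral_integral ?_ ?_ ?_ ht
    · simp [h0]
    · simp [hv0, hv']
    -- The exceptional null set depends on `ψ`; this is harmless, since the iteration uses only time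
    -- integrals for each fixed `ψ`.
    · filter_upwards [ae_all_iff.2 hw] with s hs
      have h1 := sum_divStress_fourier hrho.ne' lam mu (fun k => (V s k : 𝓢'(Space, ℂ))) ψ
      have h2 : (rho : ℂ) * ∑ i, w i s =
          -rho * ∑ k, (V s k : 𝓢'(Space, ℂ)) (𝓕 (lameOp rho lam mu ψ k)) +
            ∑ i, (∫ ξ, ψ i ξ * 𝓕 f ξ) * g s i := by
        rw [← h1, Finset.mul_sum, ← Finset.sum_add_distrib]
        refine Finset.sum_congr rfl fun i _ => ?_
        rw [hs i, integral_fourier_mul hf]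
        ring
      have h3 : ∑ i, w i s = -∑ k, (V s k : 𝓢'(Space, ℂ)) (𝓕 (lameOp rho lam mu ψ k)) +
          1 / rho * ∑ i, (∫ ξ, ψ i ξ * 𝓕 f ξ) * g s i := by
        apply mul_left_cancel₀ hrho'
        rw [h2]
        field_simp
      simp only [hd, h3]
      ring

/-- Test vectors with a single nonzero component suffice to identify the Fourier transform of the
displacement componentwise. -/
lemma isTest_single {φ : 𝓢(Space, ℂ)} (hφ : HasCompactSupport φ) (k : Fin 3) :
    ∃ r N, 0 ≤ r ∧ IsTest r (Pi.single k φ) N := by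
  obtain ⟨r, hr⟩ := hφ.isCompact.isBounded.subset_closedBall (0 : Space)
  refine ⟨|r|, ‖φ.toBoundedContinuousFunction‖, abs_nonneg r, fun i ξ => ?_⟩
  rcases eq_or_ne i k with rfl | hik
  · rw [Pi.single_eq_same]
    refine ⟨φ.toBoundedContinuousFunction.norm_coe_le_norm ξ, fun h => ?_⟩
    by_contra h0
    have := hr (subset_tsupport _ h0)
    rw [mem_closedBall_zero_iff] at this
    exact absurd (this.trans (le_abs_self r)) (not_le.2 h)
  · rw [Pi.single_eq_of_ne hik]
    simp

/-- The spatial source with Fourier transform `F`, evaluated at `x` after Fourier inversion. -/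
noncomputable def pointWeight (F : Space → ℂ) (x ξ : Space) : ℂ :=
  Complex.exp ((2 * Real.pi * inner ℝ ξ x : ℝ) * Complex.I) * F ξ

lemma norm_pointWeight (F : Space → ℂ) (x ξ : Space) : ‖pointWeight F x ξ‖ = ‖F ξ‖ := by
  rw [pointWeight, norm_mul, Complex.norm_exp_ofReal_mul_I, one_mul]

lemma integrable_pointWeight {F : Space → ℂ} (hF : Integrable F) (x : Space) :
    Integrable (pointWeight F x) := by
  refine hF.bdd_mul (c := 1) (Continuous.aestronglyMeasurable (by fun_prop)) ?_
  exact Filter.Eventually.of_forall fun ξ => (Complex.norm_exp_ofReal_mul_I _).le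

/-- The response at `x` to an impulse in the direction `e_i`, in the direction `e_k`; here `K` is
the fundamental solution or one of its derivatives. -/
noncomputable def pointKernel (rho : ℝ) (F : Space → ℂ) (x : Space)
    (K : Fin 3 → Fin 3 → ℝ → Space → ℝ) (i k : Fin 3) (τ : ℝ) : ℂ :=
  1 / rho * symbolIntegral (K i k) (pointWeight F x) τ

/-- The Fourier transform of the displacement. -/
lemma fourier_ae_eq (hrho : 0 < rho) (hmu : 0 < mu) (hL : 0 < lam + 2 * mu)
    (hf : Integrable f) (hF : Integrable (𝓕 f)) (hF1 : Integrable fun ξ => ‖ξ‖ * ‖𝓕 f ξ‖)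
    (hg : MemLp g 2 (volume.restrict (Ioo 0 T))) {V : ℝ → Fin 3 → L2}
    (hV : ∀ i, ContinuousOn (fun t => V t i) (Icc 0 T))
    (hweak : ∀ (i : Fin 3) (φ : 𝓢(Space, ℂ)), ∃ v w : ℝ → ℂ,
      IsH2 T (fun t => (V t i : 𝓢'(Space, ℂ)) φ) v w ∧
      (V 0 i : 𝓢'(Space, ℂ)) φ = 0 ∧ v 0 = 0 ∧
      ∀ᵐ t ∂volume.restrict (Ioo 0 T), (rho : ℂ) * w t =
        divStress lam mu (fun k => (V t k : 𝓢'(Space, ℂ))) i φ + g t i * ∫ x, φ x * f x)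
    {t : ℝ} (ht : t ∈ Icc 0 T) (k : Fin 3) :
    (𝓕 (V t k) : L2) =ᵐ[volume] fun ξ => 1 / rho * ∑ i, 𝓕 f ξ * ∫ s in (0 : ℝ)..t,
      (kern (speedL rho lam mu) (speedT rho mu) i k (t - s) ξ : ℂ) * g s i := by
  have hgi := fun i => intervalIntegrable_of_memLp (hg.eval_piLp i) ht
  have hEi : Integrable fun ξ => 1 / (rho : ℂ) * ∑ i, 𝓕 f ξ * ∫ s in (0 : ℝ)..t,
      (kern (speedL rho lam mu) (speedT rho mu) i k (t - s) ξ : ℂ) * g s i :=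
    (integrable_finsetSum _ fun i _ => integrable_mul_conv_kern ht.1 (hgi i) hF).const_mul _
  refine ae_eq_of_integral_schwartz_mul_eq ((Lp.memLp _).locallyIntegrable (by norm_num))
    hEi.locallyIntegrable fun φ hφ => ?_
  obtain ⟨r, N, hr, htest⟩ := isTest_single hφ k
  have h := sum_pairing_eq_duhamel (ht.1.trans ht.2) hrho hmu hL hf hF hF1 hg hV hweak hr htest ht
  simp only [toTemperedDistribution_fourier_apply] at h
  rw [Finset.sum_eq_single k (fun i _ hi => by simp [Pi.single_eq_of_ne hi]) (by simp),
    Pi.single_eq_same] at h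
  rw [h, duhamel]
  have hk : ∀ i τ, testKernel rho lam mu (𝓕 f) (Pi.single k φ) i τ = symbolIntegral
      (kern (speedL rho lam mu) (speedT rho mu) i k) (fun ξ => φ ξ * 𝓕 f ξ) τ := by
    intro i τ
    rw [testKernel, Finset.sum_eq_single k (fun j _ hj => by
      simp [symbolIntegral, Pi.single_eq_of_ne hj]) (by simp), Pi.single_eq_same]
  have hφF := integrable_schwartz_mul hF φ
  simp_rw [hk, ← integral_mul_conv_kern ht.1 (hgi _) hφF]
  rw [← integral_finsetSum _ fun i _ => integrable_mul_conv_kern ht.1 (hgi i) hφF,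
    ← integral_const_mul]
  refine integral_congr_ae (Filter.Eventually.of_forall fun ξ => ?_)
  simp only [Finset.mul_sum]
  exact Finset.sum_congr rfl fun i _ => by ring_nf

/-- The displacement at a point is a convolution of the temporal source. -/
lemma IsSolution.eq_matrixConv (hrho : 0 < rho) (hmu : 0 < mu) (hL : 0 < lam + 2 * mu)
    (hf : Integrable f) (hF : Integrable (𝓕 f)) (hF1 : Integrable fun ξ => ‖ξ‖ * ‖𝓕 f ξ‖)
    (hg : MemLp g 2 (volume.restrict (Ioo 0 T))) {U : ℝ → Space → Vec}
    (hU : IsSolution rho lam mu T f g U) (x : Space) {t : ℝ} (ht : t ∈ Icc 0 T) :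
    U t x = matrixConv (pointKernel rho (𝓕 f) x (kern (speedL rho lam mu) (speedT rho mu))) g t := by
  obtain ⟨V, hV, hUV, hweak⟩ := hU
  obtain ⟨hUc, hVU⟩ := hUV t ht
  have hgi := fun i => intervalIntegrable_of_memLp (hg.eval_piLp i) ht
  ext k
  set E : Space → ℂ := fun ξ => 1 / rho * ∑ i, 𝓕 f ξ * ∫ s in (0 : ℝ)..t,
      (kern (speedL rho lam mu) (speedT rho mu) i k (t - s) ξ : ℂ) * g s i with hE
  have hEi : Integrable E :=
    (integrable_finsetSum _ fun i _ => integrable_mul_conv_kern ht.1 (hgi i) hF).const_mul _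
  have hVE : (𝓕 (V t k) : L2) =ᵐ[volume] E :=
    fourier_ae_eq hrho hmu hL hf hF hF1 hg hV hweak ht k
  have hEc : Continuous (𝓕⁻ E) :=
    VectorFourier.fourierIntegral_continuous Real.continuous_fourierChar
      (by simpa using! continuous_inner.neg) hEi
  -- Both sides are continuous in `x`, so equality almost everywhere becomes equality at each point,
  -- in particular at the observation point.
  have hUE : (fun x => U t x k) = 𝓕⁻ E := by
    have hUk : Continuous fun x => U t x k := by fun_prop
    exact (hUk.ae_eq_iff_eq volume hEc).1
      ((hVU k).symm.trans (ae_eq_fourierInv_of_fourier_ae_eq hEi hVE))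
  have hω := integrable_pointWeight hF x
  rw [congrFun hUE x, fourierInv_eq_integral, matrixConv_apply]
  simp only [pointKernel, mul_assoc, intervalIntegral.integral_const_mul]
  simp_rw [← integral_mul_conv_kern ht.1 (hgi _) hω]
  rw [← Finset.mul_sum, ← integral_finsetSum _ fun i _ =>
    integrable_mul_conv_kern ht.1 (hgi i) hω, ← integral_const_mul]
  refine integral_congr_ae (Filter.Eventually.of_forall fun ξ => ?_)
  simp only [hE, Finset.mul_sum, pointWeight]
  exact Finset.sum_congr rfl fun i _ => by ring_nf

end Representation

end Lame

/-! ### The response at a point and the stability constant -/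

namespace Lame

open FourierTransform

/-- The bound of the second derivative of the response at a point to an impulse. -/
noncomputable def responseBound (rho lam mu p M : ℝ) : ℝ :=
  1 / rho * ((speedL rho lam mu + 2 * speedT rho mu) * (sobolevConst p * M))

/-- The stability constant. -/
noncomputable def stabilityConst (rho lam mu p T M δ : ℝ) : ℝ :=
  volterraConst (1 / (δ / rho)) (9 * responseBound rho lam mu p M / (δ / rho) + 1) T

lemma stabilityConst_pos {rho δ : ℝ} (hrho : 0 < rho) (hδ : 0 < δ) (lam mu p T M : ℝ) :
    0 < stabilityConst rho lam mu p T M δ := by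
  unfold stabilityConst volterraConst
  positivity

lemma continuous_pointKernel {rho a b : ℝ} (ha : a ≠ 0) (hb : b ≠ 0) {F : Space → ℂ}
    (hF : Integrable F) (x : Space) (i k : Fin 3) :
    Continuous (pointKernel rho F x (kern a b) i k) :=
  continuous_const.mul <| continuous_iff_continuousAt.2 fun τ =>
    (hasDerivAt_kernIntegral ha hb (integrable_pointWeight hF x) τ).continuousAt

/-- The response at `x₀` to a temporal source is of class `H²`, and its second derivative controls
the source. -/
lemma isH2_response {rho lam mu T p M δ : ℝ} (hT : 0 < T) (hrho : 0 < rho) (hmu : 0 < mu)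
    (hL : 0 < lam + 2 * mu) (hM : 0 < M) (hδ : 0 < δ) {F : Space → ℂ} (hF : Integrable F)
    (hF1 : Integrable fun ξ => ‖ξ‖ * ‖F ξ‖) (hFM : ∫ ξ, ‖ξ‖ * ‖F ξ‖ ≤ sobolevConst p * M)
    {x : Space} (hx : δ ≤ ‖𝓕⁻ F x‖) {g : ℝ → Vec} (hg : MemLp g 2 (volume.restrict (Ioo 0 T))) :
    ∃ v w : ℝ → Vec,
      IsH2 T (matrixConv (pointKernel rho F x (kern (speedL rho lam mu) (speedT rho mu))) g) v w ∧
      eLpNorm g 2 (volume.restrict (Ioo 0 T)) ≤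
        ENNReal.ofReal (stabilityConst rho lam mu p T M δ) *
          eLpNorm w 2 (volume.restrict (Ioo 0 T)) := by
  have ha := speedL_pos hrho hL
  have hb := speedT_pos hrho hmu
  have hω := integrable_pointWeight hF x
  have hω1 : Integrable fun ξ => ‖ξ‖ * ‖pointWeight F x ξ‖ := by
    simpa only [norm_pointWeight] using hF1
  have hnr : ‖(1 / (rho : ℂ))‖ = 1 / rho := by
    rw [← Complex.ofReal_one, ← Complex.ofReal_div, Complex.norm_real,
      Real.norm_of_nonneg (by positivity)]
  have hint : ∫ ξ, pointWeight F x ξ = 𝓕⁻ F x := (fourierInv_eq_integral F x).symm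
  have hsob : 0 ≤ sobolevConst p := by unfold sobolevConst; positivity
  -- Evaluating the kernel's first derivative at time 0 gives the inverse Fourier integral of `F` at
  -- `x`, divided by `rho`; hence the lower bound `δ / rho`.
  refine isH2_matrixConv (z := 1 / rho * 𝓕⁻ F x) hT (div_pos hδ hrho)
    (by unfold responseBound; positivity) ?_
    (κ' := pointKernel rho F x (kernDeriv (speedL rho lam mu) (speedT rho mu)))
    (κ'' := pointKernel rho F x (kernDeriv2 (speedL rho lam mu) (speedT rho mu)))
    (fun i k => by simp [pointKernel]) (fun i k => ?_) (fun i k τ => ?_) (fun i k τ => ?_)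
    (fun i k => ?_) (fun i k τ => ?_) hg
  · rw [norm_mul, hnr, div_eq_inv_mul, one_div]
    gcongr
  · rw [pointKernel, kernDerivIntegral_zero, hint]
    split_ifs <;> simp
  · exact (hasDerivAt_kernIntegral ha.ne' hb.ne' hω τ).const_mul _
  · exact (hasDerivAt_kernDerivIntegral ha.le hb.le hω hω1 τ).const_mul _
  · exact continuous_const.mul (continuous_kernDeriv2Integral ha.le hb.le hω.1 hω1)
  · rw [pointKernel, norm_mul, hnr, responseBound]
    refine mul_le_mul_of_nonneg_left ((norm_kernDeriv2Integral_le ha.le hb.le hω1 τ).trans ?_)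
      (by positivity)
    simp only [norm_pointWeight]
    exact mul_le_mul_of_nonneg_left hFM (by positivity)

end Lame

/-! ### The stability estimate and uniqueness -/

theorem theorem4p2 (rho lam mu : ℝ) (hrho : 0 < rho) (hmu : 0 < mu) (hlam : 0 < 3 * lam + 2 * mu)
    (p R T M δ : ℝ) (hp : 5 / 2 < p) (hT : 0 < T) (hM : 0 < M) (hδ : 0 < δ)
    (x₀ : Lame.Space) (hx₀ : x₀ ∈ Metric.ball (0 : Lame.Space) R) :
    ∃ C : ℝ, 0 < C ∧ ∀ f ∈ Lame.admissible x₀ p δ M R,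
      (∀ g : ℝ → Lame.Vec, MemLp g 2 (volume.restrict (Ioo 0 T)) →
        ∀ U : ℝ → Lame.Space → Lame.Vec, Lame.IsSolution rho lam mu T f g U →
          ∃ v w : ℝ → Lame.Vec, Lame.IsH2 T (fun t => U t x₀) v w ∧
            eLpNorm g 2 (volume.restrict (Ioo 0 T)) ≤
              ENNReal.ofReal C * eLpNorm w 2 (volume.restrict (Ioo 0 T))) ∧
      (∀ g₁ g₂ : ℝ → Lame.Vec, MemLp g₁ 2 (volume.restrict (Ioo 0 T)) →
        MemLp g₂ 2 (volume.restrict (Ioo 0 T)) →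
        ∀ U₁ U₂ : ℝ → Lame.Space → Lame.Vec,
          Lame.IsSolution rho lam mu T f g₁ U₁ → Lame.IsSolution rho lam mu T f g₂ U₂ →
          (∀ t ∈ Ioo 0 T, U₁ t x₀ = U₂ t x₀) →
          g₁ =ᵐ[volume.restrict (Ioo 0 T)] g₂) := by
  -- `3(lam + 2 mu) = (3 lam + 2 mu) + 4 mu`; this makes the longitudinal wave speed real and
  -- positive.
  have hL : 0 < lam + 2 * mu := by linarith
  refine ⟨Lame.stabilityConst rho lam mu p T M δ,
    Lame.stabilityConst_pos hrho hδ lam mu p T M, fun f hf => ?_⟩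
  have hfi := Lame.integrable_of_admissible hf
  obtain ⟨hF, hF1, hFM⟩ := Lame.fourier_of_sobolevNormLE hp hfi hf.2.1
  have hx : δ ≤ ‖FourierTransformInv.fourierInv (FourierTransform.fourier f) x₀‖ := by
    rw [hf.1.fourierInv_fourier_eq hfi hF]
    exact hf.2.2.1
  have hresp := fun (g : ℝ → Lame.Vec) (hg : MemLp g 2 (volume.restrict (Ioo 0 T))) =>
    Lame.isH2_response (p := p) hT hrho hmu hL hM hδ hF hF1 hFM hx hg
  refine ⟨fun g hg U hU => ?_, fun g₁ g₂ hg₁ hg₂ U₁ U₂ hU₁ hU₂ h12 => ?_⟩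
  · obtain ⟨v, w, hH, hle⟩ := hresp g hg
    exact ⟨v, w, hH.congr hT.le fun t ht =>
      hU.eq_matrixConv hrho hmu hL hfi hF hF1 hg x₀ ht, hle⟩
  · have hg := hg₁.sub hg₂
    -- The estimate is applied to the convolution with `g₁ - g₂`, which on `(0,T)` equals `U₁ - U₂`
    -- at `x₀` by linearity, so that `U₁ - U₂` need not be shown to be a solution.
    obtain ⟨v, w, hH, hle⟩ := hresp (g₁ - g₂) hg
    have hw := hH.ae_eq_zero hT (by ext k; simp [Lame.matrixConv_apply]) fun t ht => by
      have ht' := Ioo_subset_Icc_self ht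
      rw [Lame.matrixConv_sub (fun i k => Lame.continuous_pointKernel
          (Lame.speedL_pos hrho hL).ne' (Lame.speedT_pos hrho hmu).ne' hF x₀ i k) hg₁ hg₂ ht',
        ← hU₁.eq_matrixConv hrho hmu hL hfi hF hF1 hg₁ x₀ ht',
        ← hU₂.eq_matrixConv hrho hmu hL hfi hF hF1 hg₂ x₀ ht', h12 t ht, sub_self]
    rw [eLpNorm_congr_ae hw, eLpNorm_zero, mul_zero, nonpos_iff_eq_zero,
      eLpNorm_eq_zero_iff hg.1 (by norm_num)] at hle
    filter_upwards [hle] with t ht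
    exact sub_eq_zero.1 ht
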